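/- Let $\eta=\mathrm{diag}(-1,1,1)$ be the metric of 3-dimensional Minkowski space, with cross product determined by $\eta(v\times w,z)=\epsilon(v,w,z)$, and let $j$ be the split-complex unit, $j^2=1$, $\bar j=-j$. Consider a smooth inelastic flow $\gamma(t,x)$ of spacelike curves ($t$, $x$ in open intervals), $\eta(\gamma_x,\gamma_x)=1$, with non-null principal normal, $\mp\eta(\gamma_{xx},\gamma_{xx})>0$ (upper sign: timelike, lower sign: spacelike normal). Let $T=\gamma_x,e_1,e_2$ be a smooth parallel frame: $\eta(T,e_i)=\eta(e_1,e_2)=0$, $\eta(e_1,e_1)=-\eta(e_2,e_2)=\mp1$, $T\times e_1=e_2$, and $e_{1x}$, $e_{2x}$ are parallel to $T$. Write $\gamma_t=h_\parallel T+h_1e_1+h_2e_2$, $e_{ix}=u_iT$, $e_{1t}=\omega_1T+\omega_0e_2$, $e_{2t}=\omega_2T+\omega_0e_1$, and put $u=u_1+ju_2$, $\omega=\omega_1+j\omega_2$, $h_\perp=\pm(h_1-jh_2)$. (a) The decompositions above hold, and $$u_t=D_x\omega\mp juD_x^{-1}\mathrm{Im}(\omega\bar u)=\mathcal H(\omega),\qquad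 \omega=D_xh_\perp\mp uD_x^{-1}\mathrm{Re}(\bar uh_\perp)=\mathcal J(h_\perp),\qquad u_t=\mathcal R^2(h_\perp),$$ where, with $\mathcal C$ the conjugation, $$\mathcal H=D_x\pm juD_x^{-1}\mathrm{Im}(u\mathcal C),\quad \mathcal J=D_x\mp uD_x^{-1}\mathrm{Re}(u\mathcal C),\quad \mathcal R=j(D_x\mp uD_x^{-1}\mathrm{Re}(u\mathcal C)).$$ Here $D_x^{-1}$ is integration from any base point $x_0$ of the curve, with the integration constants fixed by the values of $\omega_0$ and $h_\parallel$ at $x_0$, so that $D_x^{-1}\mathrm{Im}(\omega\bar u)=\mp\omega_0$ and $D_x^{-1}\mathrm{Re}(\bar uh_\perp)=\mp h_\parallel$. (b) Let $\mathcal I=j$. On smooth compactly supported split-complex fields $u$, with the skew-adjoint inverse $D_x^{-1}=\frac12(\int_{-\infty}^x-\int_x^\infty)$: - $\mathcal H,\mathcal J,\mathcal I,\mathcal R$ are invariant under $u\mapsto e^{-j\phi}u$ (that is, equivariant: replacing $u$ and the argument by their multiples by $e^{-j\phi}$ multiplies the value by $e^{-j\phi}$). - $\mathcal H$ and $\mathcal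 I$ are Hamiltonian operators: the bracket $\{\mathfrak F,\mathfrak G\}_{\mathcal D}=\int\mathrm{Re}\big((\delta\mathfrak F/\delta u)\,\mathcal D(\delta\mathfrak G/\delta\bar u)\big)dx$ is skew and satisfies the Jacobi identity for all functionals on the jet space of $u,\bar u$ whose densities, for $x$ outside some compact set, vanish to second order at $u=0$. They are compatible: $c_1\mathcal H+c_2\mathcal I$ is Hamiltonian for all real $c_1,c_2$. - $\mathcal J$ is a symplectic operator (it defines a skew, closed 2-form), and it is compatible with $\mathcal H$ and with $\mathcal I$: the formal operators $c_1\mathcal H+c_2\mathcal J^{-1}=(c_1\mathcal H\mathcal J+c_2)\mathcal J^{-1}$ and $c_1\mathcal I+c_2\mathcal J^{-1}=(c_1\mathcal I\mathcal J+c_2)\mathcal J^{-1}$ are Hamiltonian for all real $c_1,c_2$, in the sense that the graph $\{(\mathcal JY,\mathcal PY)\}$ of a quotient $\mathcal P\mathcal J^{-1}$ is isotropic and integrable (skew-symmetry and the trivector form of the Jacobi identity). - $\mathcal H\mathcal I^{-1}=\mathcal I\mathcal J=\mathcal R$, $\mathcal J\mathcal I=\mathcal I^{-1}\mathcal H$,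 $\mathcal H\mathcal J=\mathcal R^2$. - $\mathcal R$ is a hereditary recursion operator: $\mathcal R'[\mathcal RX]Y-\mathcal R'[\mathcal RY]X=\mathcal R(\mathcal R'[X]Y-\mathcal R'[Y]X)$ for all $X,Y$, and for each $n\ge0$ it is a recursion operator of the flow $u_t=K(u)=\mathcal R^n(ju)$, that is, $\mathcal R'[K]=[K',\mathcal R]$. -/

import Mathlib

open scoped ContDiff

noncomputable section

namespace SpacelikeCurveFlow

/-! ### Split-complex numbers -/

/-- The split-complex (hyperbolic) numbers `a + j b` with `j ^ 2 = 1`; `star` is the conjugation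
`a + j b ↦ a - j b`. -/
abbrev SplitC : Type := QuadraticAlgebra ℝ 1 0

/-- The hyperbolic unit `j`, as an invertible element (it is its own inverse). -/
def jUnit : SplitCˣ where
  val := ⟨0, 1⟩
  inv := ⟨0, 1⟩
  val_inv := by rw [QuadraticAlgebra.mk_mul_mk]; ext <;> norm_num <;> rfl
  inv_val := by rw [QuadraticAlgebra.mk_mul_mk]; ext <;> norm_num <;> rfl

/-- The hyperbolic unit `j`. -/
def jj : SplitC := ↑jUnit

/-- `exp (j φ) = cosh φ + j sinh φ`. -/
def hexp (φ : ℝ) : SplitC := ⟨Real.cosh φ, Real.sinh φ⟩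

/-- The derivative `D_x f` of a split-complex valued function. -/
def dx (f : ℝ → SplitC) (x : ℝ) : SplitC :=
  ⟨deriv (fun y => (f y).re) x, deriv (fun y => (f y).im) x⟩

/-! ### The operators

They are written for an arbitrary choice `Dinv` of the antiderivative `D_x⁻¹` on real functions;
`ε = 1` is the upper sign and `ε = -1` the lower sign. -/

/-- `H = D_x ± j u D_x⁻¹ Im (u C)`. -/
def opH (ε : ℝ) (Dinv : (ℝ → ℝ) → ℝ → ℝ) (u w : ℝ → SplitC) (x : ℝ) : SplitC :=
  dx w x + (ε * Dinv (fun y => (u y * star (w y)).im) x) • (jj * u x)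

/-- `J = D_x ∓ u D_x⁻¹ Re (u C)`. -/
def opJ (ε : ℝ) (Dinv : (ℝ → ℝ) → ℝ → ℝ) (u h : ℝ → SplitC) (x : ℝ) : SplitC :=
  dx h x - (ε * Dinv (fun y => (u y * star (h y)).re) x) • u x

/-- `I = j`. -/
def opI (_u w : ℝ → SplitC) (x : ℝ) : SplitC := (jUnit : SplitC) * w x

/-- `I⁻¹`. -/
def opIinv (_u w : ℝ → SplitC) (x : ℝ) : SplitC := (↑(jUnit⁻¹) : SplitC) * w x

/-- `R = j (D_x ∓ u D_x⁻¹ Re (u C))`. -/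
def opR (ε : ℝ) (Dinv : (ℝ → ℝ) → ℝ → ℝ) (u h : ℝ → SplitC) (x : ℝ) : SplitC :=
  jj * (dx h x - (ε * Dinv (fun y => (u y * star (h y)).re) x) • u x)

/-- The antiderivative with value `c` at the base point `x₀`. -/
def antideriv (x₀ c : ℝ) (f : ℝ → ℝ) (x : ℝ) : ℝ := c + ∫ y in x₀..x, f y

/-- The skew-adjoint inverse `D_x⁻¹ = (∫_{-∞}^x - ∫_x^∞) / 2` of `D_x`
on compactly supported functions. -/
def skewInv (f : ℝ → ℝ) (x : ℝ) : ℝ :=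
  (1 / 2) * ((∫ y in Set.Iic x, f y) - ∫ y in Set.Ioi x, f y)

/-! ### Three-dimensional Minkowski space and inelastic curve flows -/

/-- Vectors of 3-dimensional Minkowski space in inertial coordinates `(X⁰, X¹, X²)`. -/
abbrev Mink : Type := Fin 3 → ℝ

/-- The Minkowski metric `diag (-1, 1, 1)`. -/
def eta (v w : Mink) : ℝ := -(v 0 * w 0) + v 1 * w 1 + v 2 * w 2

/-- The cross product: `eta (mcross v w) x` is the volume form `ε (v, w, x)`
normalised by `ε₀₁₂ = 1`. -/
def mcross (v w : Mink) : Mink :=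
  ![-(v 1 * w 2 - v 2 * w 1), v 2 * w 0 - v 0 * w 2, v 0 * w 1 - v 1 * w 0]

theorem eta_mcross (v w x : Mink) :
    eta (mcross v w) x = Matrix.det (Matrix.of ![v, w, x]) := by
  simp [eta, mcross, Matrix.det_fin_three]
  ring

/-- The derivative in `x` of `f (t, x)`. -/
def px (f : ℝ → ℝ → Mink) (t x : ℝ) : Mink := deriv (fun y => f t y) x

/-- The derivative in `t` of `f (t, x)`. -/
def pt (f : ℝ → ℝ → Mink) (t x : ℝ) : Mink := deriv (fun s => f s x) t

/-- `γ (t, x)`, for `t` in an open interval `A` and `x` in an open interval `K`, is a smooth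
inelastic flow of spacelike curves parametrised by proper distance `x` whose principal normal
`T_x = γ_xx` is non-null: timelike for `ε = 1` and spacelike for `ε = -1`. -/
structure IsInelasticFlow (ε : ℝ) (A K : Set ℝ) (γ : ℝ → ℝ → Mink) : Prop where
  openA : IsOpen A
  ordA : A.OrdConnected
  openK : IsOpen K
  ordK : K.OrdConnected
  smooth : ContDiffOn ℝ ∞ (fun p : ℝ × ℝ => γ p.1 p.2) (A ×ˢ K)
  unit : ∀ t ∈ A, ∀ x ∈ K, eta (px γ t x) (px γ t x) = 1
  nonnull : ∀ t ∈ A, ∀ x ∈ K, 0 < -ε * eta (px (px γ) t x) (px (px γ) t x)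

/-- `T = γ_x, e₁, e₂` is a smooth Lorentzian parallel frame along the flow `γ`: it is orthogonal
with `η(e₁,e₁) = -η(e₂,e₂) = ∓ 1`, oriented by `T × e₁ = e₂`, and the `x`-derivatives of
`e₁` and `e₂` are tangential. -/
structure IsParallelFrame (ε : ℝ) (A K : Set ℝ) (γ e₁ e₂ : ℝ → ℝ → Mink) : Prop where
  smooth₁ : ContDiffOn ℝ ∞ (fun p : ℝ × ℝ => e₁ p.1 p.2) (A ×ˢ K)
  smooth₂ : ContDiffOn ℝ ∞ (fun p : ℝ × ℝ => e₂ p.1 p.2) (A ×ˢ K)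
  norm₁ : ∀ t ∈ A, ∀ x ∈ K, eta (e₁ t x) (e₁ t x) = -ε
  norm₂ : ∀ t ∈ A, ∀ x ∈ K, eta (e₂ t x) (e₂ t x) = ε
  orth₁ : ∀ t ∈ A, ∀ x ∈ K, eta (px γ t x) (e₁ t x) = 0
  orth₂ : ∀ t ∈ A, ∀ x ∈ K, eta (px γ t x) (e₂ t x) = 0
  orth₁₂ : ∀ t ∈ A, ∀ x ∈ K, eta (e₁ t x) (e₂ t x) = 0
  orient : ∀ t ∈ A, ∀ x ∈ K, mcross (px γ t x) (e₁ t x) = e₂ t x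
  parallel₁ : ∀ t ∈ A, ∀ x ∈ K, ∃ c : ℝ, px e₁ t x = c • px γ t x
  parallel₂ : ∀ t ∈ A, ∀ x ∈ K, ∃ c : ℝ, px e₂ t x = c • px γ t x

/-- `u = u₁ + j u₂`, where `(e_i)_x = u_i T`. -/
def covU (γ e₁ e₂ : ℝ → ℝ → Mink) (t x : ℝ) : SplitC :=
  ⟨eta (px e₁ t x) (px γ t x), eta (px e₂ t x) (px γ t x)⟩

/-- The derivative `u_t`. -/
def covUt (γ e₁ e₂ : ℝ → ℝ → Mink) (t x : ℝ) : SplitC :=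
  ⟨deriv (fun s => (covU γ e₁ e₂ s x).re) t, deriv (fun s => (covU γ e₁ e₂ s x).im) t⟩

/-- `ω = ω₁ + j ω₂`, where `ω_i` is the `T`-component of `(e_i)_t`. -/
def covOmega (γ e₁ e₂ : ℝ → ℝ → Mink) (t x : ℝ) : SplitC :=
  ⟨eta (pt e₁ t x) (px γ t x), eta (pt e₂ t x) (px γ t x)⟩

/-- `ω₀`, the `e₂`-component of `(e₁)_t`. -/
def omega0 (ε : ℝ) (e₁ e₂ : ℝ → ℝ → Mink) (t x : ℝ) : ℝ := ε * eta (pt e₁ t x) (e₂ t x)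

/-- The tangential component of `γ_t`. -/
def hPar (γ : ℝ → ℝ → Mink) (t x : ℝ) : ℝ := eta (pt γ t x) (px γ t x)

/-- The `e₁`-component of `γ_t` (recall `η(e₁,e₁) = -ε`). -/
def h1 (ε : ℝ) (γ e₁ : ℝ → ℝ → Mink) (t x : ℝ) : ℝ := -ε * eta (pt γ t x) (e₁ t x)

/-- The `e₂`-component of `γ_t` (recall `η(e₂,e₂) = ε`). -/
def h2 (ε : ℝ) (γ e₂ : ℝ → ℝ → Mink) (t x : ℝ) : ℝ := ε * eta (pt γ t x) (e₂ t x)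

/-- `h_⊥ = ± (h₁ - j h₂)`. -/
def hPerp (ε : ℝ) (γ e₁ e₂ : ℝ → ℝ → Mink) (t x : ℝ) : SplitC :=
  ε • (⟨h1 ε γ e₁ t x, -h2 ε γ e₂ t x⟩ : SplitC)

/-! ### Operators on fields -/

/-- Smooth compactly supported split-complex fields. -/
def IsTest (u : ℝ → SplitC) : Prop :=
  ContDiff ℝ ∞ (fun x => (u x).re) ∧ ContDiff ℝ ∞ (fun x => (u x).im) ∧ HasCompactSupport u

/-- An operator on fields which may depend on the field `u` (the first argument). -/
abbrev FieldOp : Type := (ℝ → SplitC) → (ℝ → SplitC) → ℝ → SplitC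

/-- The Gateaux derivative of `u ↦ K u` at `u` in the direction `w`. -/
def vder (K : (ℝ → SplitC) → ℝ → SplitC) (u w : ℝ → SplitC) (x : ℝ) : SplitC :=
  ⟨deriv (fun s : ℝ => (K (u + s • w) x).re) 0, deriv (fun s : ℝ => (K (u + s • w) x).im) 0⟩

/-- The Gateaux derivative of `u ↦ K u` at `u` in the direction `w` exists pointwise. -/
def VDiff (K : (ℝ → SplitC) → ℝ → SplitC) (u w : ℝ → SplitC) : Prop :=
  ∀ x, DifferentiableAt ℝ (fun s : ℝ => (K (u + s • w) x).re) 0 ∧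
    DifferentiableAt ℝ (fun s : ℝ => (K (u + s • w) x).im) 0

/-- The Gateaux derivative `D'[w] X` of the operator `D` at `u`, in the direction `w`. -/
def opDer (D : FieldOp) (u w X : ℝ → SplitC) : ℝ → SplitC := vder (fun v => D v X) u w

/-- `D u` is a linear operator on test fields, differentiable in `u`. -/
structure IsFieldOp (D : FieldOp) : Prop where
  maps : ∀ u X, IsTest u → IsTest X → IsTest (D u X)
  linear : ∀ u X Y, IsTest u → IsTest X → IsTest Y → ∀ a : ℝ,
    D u (a • X + Y) = a • D u X + D u Y
  diff : ∀ u w X, IsTest u → IsTest w → IsTest X → VDiff (fun v => D v X) u w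

/-- The linear combination `c₁ D₁ + c₂ D₂`. -/
def linComb (c₁ c₂ : ℝ) (D₁ D₂ : FieldOp) : FieldOp := fun u X => c₁ • D₁ u X + c₂ • D₂ u X

/-- The composition `D₁ D₂`. -/
def opComp (D₁ D₂ : FieldOp) : FieldOp := fun u X => D₁ u (D₂ u X)

/-- `SO(1,1)`-invariance: `D` is equivariant under the hyperbolic phase rotations
`u ↦ exp (-j φ) u`. -/
def IsPhaseInvariant (D : FieldOp) : Prop :=
  ∀ φ : ℝ, ∀ u X, IsTest u → IsTest X →
    D (fun x => hexp (-φ) * u x) (fun x => hexp (-φ) * X x) = fun x => hexp (-φ) * D u X x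

/-! ### Functionals on the jet space and Poisson brackets -/

/-- The `n`-jet `(u₁, u₂), (u₁, u₂)_x, …` of a field at `x`, in real components. -/
def jet (n : ℕ) (u : ℝ → SplitC) (x : ℝ) : Fin (n + 1) → ℝ × ℝ := fun k =>
  (iteratedDeriv k (fun y => (u y).re) x, iteratedDeriv k (fun y => (u y).im) x)

/-- A density `f (x, u, u_x, …)`: a smooth function on a finite-order jet space. Outside a compact
set of `x` it vanishes to second order at the zero jet, so that the functional `∫ f dx` is finite
and its variational derivative is compactly supported, for every test field. -/
structure Density where
  order : ℕ
  f : ℝ → (Fin (order + 1) → ℝ × ℝ) → ℝ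
  smooth : ContDiff ℝ ∞ (fun p : ℝ × (Fin (order + 1) → ℝ × ℝ) => f p.1 p.2)
  decay : ∃ S : Set ℝ, IsCompact S ∧ ∀ x ∉ S, f x 0 = 0 ∧ fderiv ℝ (f x) 0 = 0

/-- The functional `∫ f dx`. -/
def Density.val (F : Density) (u : ℝ → SplitC) : ℝ := ∫ x, F.f x (jet F.order u x)

/-- The Euler operator with respect to the real component of `u` in the direction `e`:
`∑ (-D_x)^k (∂ f / ∂ u_k)`, where `e = (1, 0)` for `u₁` and `e = (0, 1)` for `u₂`. -/
def Density.euler (F : Density) (e : ℝ × ℝ) (u : ℝ → SplitC) (x : ℝ) : ℝ :=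
  ∑ k : Fin (F.order + 1), (-1) ^ (k : ℕ) *
    iteratedDeriv k (fun y => fderiv ℝ (F.f y) (jet F.order u y) (Pi.single k e)) x

/-- `δF/δu = (δF/δu₁ + j δF/δu₂) / 2`. -/
def Density.dU (F : Density) (u : ℝ → SplitC) (x : ℝ) : SplitC :=
  (1 / 2 : ℝ) • (⟨F.euler (1, 0) u x, F.euler (0, 1) u x⟩ : SplitC)

/-- `δF/δū = (δF/δu₁ - j δF/δu₂) / 2`. -/
def Density.dUbar (F : Density) (u : ℝ → SplitC) (x : ℝ) : SplitC :=
  (1 / 2 : ℝ) • (⟨F.euler (1, 0) u x, -F.euler (0, 1) u x⟩ : SplitC)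

/-- `M = δΦ/δu` for a functional `Φ`: the derivative of `Φ` in the direction `w` is
`∫ (δΦ/δu₁ w₁ + δΦ/δu₂ w₂) dx = ∫ 2 Re ((δΦ/δu) w) dx`. -/
def IsVarDeriv (Φ : (ℝ → SplitC) → ℝ) (M : (ℝ → SplitC) → ℝ → SplitC) : Prop :=
  ∀ u, IsTest u → Continuous (fun x => (M u x).re) ∧ Continuous (fun x => (M u x).im) ∧
    ∀ w, IsTest w →
      HasDerivAt (fun s : ℝ => Φ (u + s • w)) (∫ x, 2 * (M u x * w x).re) 0

/-- `{Φ, G}_D = ∫ Re ((δΦ/δu) D (δG/δū)) dx` for a functional `Φ` with `M = δΦ/δu`. -/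
def bracketWith (D : FieldOp) (M : (ℝ → SplitC) → ℝ → SplitC) (G : Density)
    (u : ℝ → SplitC) : ℝ :=
  ∫ x, (M u x * D u (G.dUbar u) x).re

/-- The bracket `{F, G}_D = ∫ Re ((δF/δu) D (δG/δū)) dx`. -/
def bracket (D : FieldOp) (F G : Density) : (ℝ → SplitC) → ℝ := bracketWith D F.dU G

/-- `D` is a Hamiltonian operator: its bracket is skew and satisfies the Jacobi identity
`{{F, G}, L} + cyclic = 0` for all functionals on the jet space (the functionals `{F, G}`, which
may be nonlocal, possess variational derivatives). -/
structure IsHamiltonian (D : FieldOp) : Prop where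
  op : IsFieldOp D
  skew : ∀ F G : Density, ∀ u, IsTest u → bracket D F G u + bracket D G F u = 0
  jacobi : ∀ F G L : Density, ∃ M₁ M₂ M₃,
    IsVarDeriv (bracket D F G) M₁ ∧ IsVarDeriv (bracket D G L) M₂ ∧
    IsVarDeriv (bracket D L F) M₃ ∧
    ∀ u, IsTest u →
      bracketWith D M₁ L u + bracketWith D M₂ F u + bracketWith D M₃ G u = 0

/-- Two Hamiltonian operators are compatible if all their linear combinations are Hamiltonian. -/
def AreCompatible (D₁ D₂ : FieldOp) : Prop :=
  ∀ c₁ c₂ : ℝ, IsHamiltonian (linComb c₁ c₂ D₁ D₂)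

/-- The pairing `∫ Re (conj ξ · X) dx` of a covector field `ξ` (playing the role of `δG/δū`)
with a vector field `X`. -/
def pairing (ξ X : ℝ → SplitC) : ℝ := ∫ x, (star (ξ x) * X x).re

/-- `J` is a symplectic operator: the 2-form `(X, Y) ↦ ⟨J X, Y⟩` is skew and closed. -/
structure IsSymplectic (J : FieldOp) : Prop where
  op : IsFieldOp J
  skew : ∀ u X Y, IsTest u → IsTest X → IsTest Y →
    pairing (J u X) Y + pairing (J u Y) X = 0
  closed : ∀ u X₁ X₂ X₃, IsTest u → IsTest X₁ → IsTest X₂ → IsTest X₃ →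
    pairing (opDer J u X₁ X₂) X₃ + pairing (opDer J u X₂ X₃) X₁
      + pairing (opDer J u X₃ X₁) X₂ = 0

/-- The formal quotient `P Q⁻¹` is a Hamiltonian operator: its graph, which consists of the pairs
`(ξ, V) = (Q Y, P Y)` of a covector and a vector, is isotropic and integrable, that is,
`⟨ξ₁, V₂⟩ + ⟨ξ₂, V₁⟩ = 0` and
`⟨ξ₂'[V₁], V₃⟩ + ⟨ξ₂, V₁'[V₃]⟩ + cyclic = 0` (the trivector form of the Jacobi identity),
where `ξᵢ = Q Yᵢ`, `Vᵢ = P Yᵢ`. For `Q = 1` this says that `P` is skew with the Jacobi identity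
`⟨Y₂, P'[P Y₃] Y₁⟩ + cyclic = 0`, and for `P = 1` that `Q` is symplectic. -/
structure IsHamiltonianQuot (P Q : FieldOp) : Prop where
  opP : IsFieldOp P
  opQ : IsFieldOp Q
  skew : ∀ u Y₁ Y₂, IsTest u → IsTest Y₁ → IsTest Y₂ →
    pairing (Q u Y₁) (P u Y₂) + pairing (Q u Y₂) (P u Y₁) = 0
  jacobi : ∀ u Y₁ Y₂ Y₃, IsTest u → IsTest Y₁ → IsTest Y₂ → IsTest Y₃ →
    (pairing (opDer Q u (P u Y₁) Y₂) (P u Y₃) + pairing (Q u Y₂) (opDer P u (P u Y₃) Y₁))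
    + (pairing (opDer Q u (P u Y₂) Y₃) (P u Y₁) + pairing (Q u Y₃) (opDer P u (P u Y₁) Y₂))
    + (pairing (opDer Q u (P u Y₃) Y₁) (P u Y₂) + pairing (Q u Y₁) (opDer P u (P u Y₂) Y₃)) = 0

/-- A Hamiltonian operator `H` and a symplectic operator `J` are compatible if every linear
combination `c₁ H + c₂ J⁻¹ = (c₁ H J + c₂) J⁻¹` is Hamiltonian. -/
def IsCompatibleSymplectic (H J : FieldOp) : Prop :=
  ∀ c₁ c₂ : ℝ, IsHamiltonianQuot (linComb c₁ c₂ (opComp H J) (fun _ X => X)) J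

/-- `R` is hereditary: `R'[R X] Y - R'[R Y] X = R (R'[X] Y - R'[Y] X)`. -/
def IsHereditary (R : FieldOp) : Prop :=
  IsFieldOp R ∧ ∀ u X Y, IsTest u → IsTest X → IsTest Y →
    opDer R u (R u X) Y - opDer R u (R u Y) X = R u (opDer R u X Y - opDer R u Y X)

/-- `R` is a recursion operator for the flow `u_t = K(u)`: the Lie derivative of `R` along `K`
vanishes, `R'[K] = [K', R]`, so that `R` maps symmetries of the flow to symmetries. -/
def IsRecursion (R : FieldOp) (K : (ℝ → SplitC) → ℝ → SplitC) : Prop :=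
  (∀ u, IsTest u → IsTest (K u)) ∧
  (∀ u X, IsTest u → IsTest X → VDiff K u X ∧ IsTest (vder K u X)) ∧
  ∀ u X, IsTest u → IsTest X →
    opDer R u (K u) X = vder K u (R u X) - R u (vder K u X)

end SpacelikeCurveFlow

end

open SpacelikeCurveFlow

noncomputable section

namespace SpacelikeCurveFlow

open MeasureTheory Set Filter Topology

/-! For the curve flow, everything follows from equality of mixed derivatives. Expanding `γ_t`,
`T_x`, `e_{ix}`, `e_{it}` in the frame, `γ_{tx} = γ_{xt}` gives `D_x h_⊥ = ω - h_∥ u` and `D_x h_∥ =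
∓ Re (ū h_⊥)`, while `e_{itx} = e_{ixt}` gives `D_x ω = u_t - ω₀ j u` and `D_x ω₀ = ∓ Im (ω ū)`.
Integrating the two scalar equations from `x₀` turns the other two into the formulas with `J` and
`H`.

For the operators, the key reduction is that there is only one of them. Write `J_{σ,v} = D_x - σ v
D_x⁻¹ Re (v C)`. Then `J = J_{ε,u}`, `H = J_{-ε,ju}` and `R = j J`, since multiplication by `j`
reverses the sign of the inner product `Re (a b̄)` (`opH_eq_opJ`, `opJ_jmul_jmul`). Skew-adjointness
is proved once, in `pairing_opJ_skew`. The derivative of `J_{σ,v}` in `v` along `w`, paired with a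
field, is `-σ` times the trilinear form `trip` (`pairing_opJd`), so that every closure or Jacobi
identity becomes a cyclic identity for `trip`. There are three of these: `trip_cyclic` (pointwise
cancellation: `J` is symplectic), `trip_cyclic_jmul_opJ` (the cyclic sum is a total derivative:
Jacobi identity for `H`), and `trip_cyclic_opJ_opJ` (the cross term between `H` and `J⁻¹`).

The pencil `a H + b I` is treated as a single operator. In the Jacobi identity of its bracket the
second variations of the functionals cancel because they are symmetric
(`Density.pairing_vder_comm`), and what remains is `trip_cyclic_pencil`; this yields that `H` and
`I` are Hamiltonian and compatible at once. The quotients with `J` are handled in the same way in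
`isHamiltonianQuot_quotNum`.

The hereditary identity is a direct computation in which the difference of the nonlocal terms is
`D_x⁻¹` of a total derivative plus a common remainder. It propagates the relation `R'[K] = [K', R]`
from `K` to `R K`, starting from the phase rotation `K = j u`.

The analytic input is that `D_x⁻¹` is convolution with a bounded kernel, so it preserves joint
smoothness of families with a common compact support and commutes with differentiation in the
parameter. -/

/-! ### Smooth compactly supported real functions and their skew antiderivative -/

/-- Smooth compactly supported real functions. -/
structure RTest (f : ℝ → ℝ) : Prop where
  smooth : ContDiff ℝ ∞ f
  supp : HasCompactSupport f

theorem RTest.continuous {f : ℝ → ℝ} (hf : RTest f) : Continuous f := hf.smooth.continuous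

theorem RTest.integrable {f : ℝ → ℝ} (hf : RTest f) : Integrable f :=
  hf.continuous.integrable_of_hasCompactSupport hf.supp

theorem RTest.differentiable {f : ℝ → ℝ} (hf : RTest f) : Differentiable ℝ f :=
  hf.smooth.differentiable (by simp)

theorem RTest.hasDerivAt {f : ℝ → ℝ} (hf : RTest f) (x : ℝ) : HasDerivAt f (deriv f x) x :=
  (hf.differentiable x).hasDerivAt

theorem RTest.add {f g : ℝ → ℝ} (hf : RTest f) (hg : RTest g) : RTest (fun x => f x + g x) :=
  ⟨hf.smooth.add hg.smooth, hf.supp.add hg.supp⟩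

theorem RTest.neg {f : ℝ → ℝ} (hf : RTest f) : RTest (fun x => -f x) :=
  ⟨hf.smooth.neg, hf.supp.comp_left (g := fun y : ℝ => -y) (by simp)⟩

theorem RTest.sub {f g : ℝ → ℝ} (hf : RTest f) (hg : RTest g) : RTest (fun x => f x - g x) := by
  simpa [sub_eq_add_neg] using hf.add hg.neg

theorem RTest.mul_left {f g : ℝ → ℝ} (hf : ContDiff ℝ ∞ f) (hg : RTest g) :
    RTest (fun x => f x * g x) :=
  ⟨hf.mul hg.smooth, hg.supp.mul_left⟩

theorem RTest.mul_right {f g : ℝ → ℝ} (hf : RTest f) (hg : ContDiff ℝ ∞ g) :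
    RTest (fun x => f x * g x) :=
  ⟨hf.smooth.mul hg, hf.supp.mul_right⟩

theorem RTest.mul {f g : ℝ → ℝ} (hf : RTest f) (hg : RTest g) : RTest (fun x => f x * g x) :=
  hf.mul_right hg.smooth

theorem RTest.const_mul {f : ℝ → ℝ} (c : ℝ) (hf : RTest f) : RTest (fun x => c * f x) :=
  RTest.mul_left contDiff_const hf

theorem RTest.deriv {f : ℝ → ℝ} (hf : RTest f) : RTest (deriv f) :=
  ⟨hf.smooth.deriv' , hf.supp.deriv⟩

theorem skewInv_eq_sub {f : ℝ → ℝ} (hf : Integrable f) (x : ℝ) :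
    skewInv f x = (∫ y in Iic x, f y) - (1 / 2) * ∫ y, f y := by
  have h := integral_add_compl (μ := volume) (measurableSet_Iic (a := x)) hf
  rw [compl_Iic] at h
  rw [skewInv, ← h]
  ring

theorem RTest.hasDerivAt_skewInv {f : ℝ → ℝ} (hf : RTest f) (x : ℝ) :
    HasDerivAt (skewInv f) (f x) x := by
  have h : skewInv f = fun x => (∫ y in (0 : ℝ)..x, f y) +
      ((∫ y in Iic 0, f y) - (1 / 2) * ∫ y, f y) := by
    funext x
    rw [skewInv_eq_sub hf.integrable, ← intervalIntegral.integral_Iic_sub_Iic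
      hf.integrable.integrableOn hf.integrable.integrableOn]
    ring
  rw [h]
  exact (intervalIntegral.integral_hasDerivAt_right (hf.continuous.intervalIntegrable _ _)
    hf.continuous.stronglyMeasurable.stronglyMeasurableAtFilter hf.continuous.continuousAt).add_const
      _

theorem RTest.contDiff_skewInv {f : ℝ → ℝ} (hf : RTest f) : ContDiff ℝ ∞ (skewInv f) := by
  rw [contDiff_infty_iff_deriv]
  refine ⟨fun x => (hf.hasDerivAt_skewInv x).differentiableAt, ?_⟩
  have h : _root_.deriv (skewInv f) = f := funext fun x => (hf.hasDerivAt_skewInv x).deriv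
  rw [h]
  exact hf.smooth

theorem skewInv_add {f g : ℝ → ℝ} (hf : Integrable f) (hg : Integrable g) (x : ℝ) :
    skewInv (fun y => f y + g y) x = skewInv f x + skewInv g x := by
  simp only [skewInv]
  rw [integral_add hf.integrableOn hg.integrableOn, integral_add hf.integrableOn hg.integrableOn]
  ring

theorem skewInv_const_mul (c : ℝ) (f : ℝ → ℝ) (x : ℝ) :
    skewInv (fun y => c * f y) x = c * skewInv f x := by
  simp only [skewInv, integral_const_mul]
  ring

theorem skewInv_neg (f : ℝ → ℝ) (x : ℝ) : skewInv (fun y => -f y) x = -skewInv f x := by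
  simpa using skewInv_const_mul (-1) f x

theorem skewInv_sub {f g : ℝ → ℝ} (hf : Integrable f) (hg : Integrable g) (x : ℝ) :
    skewInv (fun y => f y - g y) x = skewInv f x - skewInv g x := by
  simp only [skewInv]
  rw [integral_sub hf.integrableOn hg.integrableOn, integral_sub hf.integrableOn hg.integrableOn]
  ring

/-- Compact support removes the integration constant; this is what allows a total derivative to be
pulled out of `D_x⁻¹` in the hereditary identity. -/
theorem RTest.skewInv_deriv {f : ℝ → ℝ} (hf : RTest f) (x : ℝ) :
    skewInv (_root_.deriv f) x = f x := by
  have h1 : ContDiff ℝ 1 f := hf.smooth.of_le (by simp)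
  rw [skewInv, hf.supp.integral_Iic_deriv_eq h1, hf.supp.integral_Ioi_deriv_eq h1]
  ring

/-- The device behind the nonlocal cyclic identities: exhibit a compactly supported primitive of the
integrand. -/
theorem integral_eq_zero_of_hasDerivAt {F g : ℝ → ℝ} (hF : RTest F)
    (h : ∀ x, HasDerivAt F (g x) x) : ∫ x, g x = 0 := by
  have hg : g = deriv F := funext fun x => (h x).deriv.symm
  exact integral_eq_zero_of_hasDerivAt_of_integrable h (hg ▸ hF.deriv.integrable) hF.integrable

theorem RTest.skewInv_eventually {f : ℝ → ℝ} (hf : RTest f) :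
    (∀ᶠ x in atTop, skewInv f x = (1 / 2) * ∫ y, f y) ∧
    ∀ᶠ x in atBot, skewInv f x = -((1 / 2) * ∫ y, f y) := by
  obtain ⟨r, hr⟩ := hf.supp.isCompact.isBounded.subset_closedBall 0
  have hz : ∀ y, r < |y| → f y = 0 := fun y hy => by
    by_contra h
    have := hr (subset_tsupport f h)
    simp at this
    linarith
  constructor
  · filter_upwards [eventually_ge_atTop (|r|)] with x hx
    have h0 : ∫ y in Ioi x, f y = 0 := setIntegral_eq_zero_of_forall_eq_zero fun y hy =>
      hz y (lt_of_le_of_lt ((le_abs_self r).trans hx) (lt_of_lt_of_le hy (le_abs_self y)))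
    have h := integral_add_compl (μ := volume) (measurableSet_Iic (a := x)) hf.integrable
    rw [compl_Iic, h0] at h
    rw [skewInv, h0, ← h]
    ring
  · filter_upwards [eventually_lt_atBot (-|r|)] with x hx
    have h0 : ∫ y in Iic x, f y = 0 := setIntegral_eq_zero_of_forall_eq_zero fun y hy => by
      have hy' : y ≤ x := hy
      exact hz y (by linarith [le_abs_self r, neg_abs_le y])
    rw [skewInv_eq_sub hf.integrable, h0]
    ring

/-- Antiderivatives of test functions are not compactly supported, but with the symmetric choice of
constant they tend to opposite values at the two ends. Hence the product of two of them has equal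
limits at `±∞`, and its derivative integrates to zero. -/
theorem integral_mul_skewInv {f g : ℝ → ℝ} (hf : RTest f) (hg : RTest g) :
    ∫ x, g x * skewInv f x = -∫ x, f x * skewInv g x := by
  have h1 : Integrable fun x => g x * skewInv f x := (hg.mul_right hf.contDiff_skewInv).integrable
  have h2 : Integrable fun x => f x * skewInv g x := (hf.mul_right hg.contDiff_skewInv).integrable
  have hd : ∀ x, HasDerivAt (fun x => skewInv f x * skewInv g x)
      (g x * skewInv f x + f x * skewInv g x) x := fun x => by
    exact ((hf.hasDerivAt_skewInv x).mul (hg.hasDerivAt_skewInv x)).congr_deriv (by ring)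
  obtain ⟨ft, fb⟩ := hf.skewInv_eventually
  obtain ⟨gt, gb⟩ := hg.skewInv_eventually
  have key := integral_of_hasDerivAt_of_tendsto hd (h1.add h2)
    (m := (1 / 2) * (∫ y, f y) * ((1 / 2) * ∫ y, g y))
    (n := (1 / 2) * (∫ y, f y) * ((1 / 2) * ∫ y, g y))
    (tendsto_const_nhds.congr' (by
      filter_upwards [fb, gb] with x hx hx'
      rw [hx, hx', neg_mul_neg]))
    (tendsto_const_nhds.congr' (by
      filter_upwards [ft, gt] with x hx hx'
      rw [hx, hx']))
  rw [integral_add h1 h2] at key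
  linarith

/-- The kernel of the skew-adjoint antiderivative. -/
def skewKernel (t : ℝ) : ℝ := if 0 ≤ t then 1 / 2 else -(1 / 2)

theorem measurable_skewKernel : Measurable skewKernel :=
  Measurable.ite measurableSet_Ici measurable_const measurable_const

theorem abs_skewKernel_le (t : ℝ) : |skewKernel t| ≤ 1 := by
  unfold skewKernel
  split_ifs <;> rw [abs_le] <;> norm_num

theorem locallyIntegrable_skewKernel : LocallyIntegrable skewKernel :=
  (locallyIntegrable_const (1 : ℝ)).mono measurable_skewKernel.aestronglyMeasurable
    (ae_of_all _ fun t => by simpa using abs_skewKernel_le t)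

theorem skewInv_eq_integral {f : ℝ → ℝ} (hf : Integrable f) (x : ℝ) :
    skewInv f x = ∫ y, skewKernel (x - y) * f y := by
  have hm : Integrable fun y => skewKernel (x - y) * f y :=
    hf.bdd_mul (c := 1) (measurable_skewKernel.comp (measurable_const.sub
      measurable_id)).aestronglyMeasurable
      (ae_of_all _ fun y => by simpa using abs_skewKernel_le (x - y))
  have h := integral_add_compl (μ := volume) (measurableSet_Iic (a := x)) hm
  rw [compl_Iic] at h
  have e1 : ∫ y in Iic x, skewKernel (x - y) * f y = ∫ y in Iic x, (1 / 2) * f y :=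
    setIntegral_congr_fun measurableSet_Iic fun y hy => by
      have : (0 : ℝ) ≤ x - y := sub_nonneg.2 hy
      simp only [skewKernel, if_pos this]
  have e2 : ∫ y in Ioi x, skewKernel (x - y) * f y = ∫ y in Ioi x, -(1 / 2) * f y :=
    setIntegral_congr_fun measurableSet_Ioi fun y hy => by
      have : ¬ (0 : ℝ) ≤ x - y := not_le.2 (sub_neg.2 hy)
      simp only [skewKernel, if_neg this]
  rw [e1, e2, integral_const_mul, integral_const_mul] at h
  rw [← h, skewInv]
  ring

/-! ### Smooth families of compactly supported functions -/

/-- Jointly smooth families `f s x` of functions of `x` with a common compact support. -/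
structure RFam (f : ℝ → ℝ → ℝ) : Prop where
  smooth : ContDiff ℝ ∞ (fun p : ℝ × ℝ => f p.1 p.2)
  supp : ∃ C : Set ℝ, IsCompact C ∧ ∀ s, ∀ x ∉ C, f s x = 0

/-- The derivative with respect to the parameter of a family. -/
def ds (f : ℝ → ℝ → ℝ) (s x : ℝ) : ℝ := deriv (fun r => f r x) s

theorem slice_right {f : ℝ → ℝ → ℝ} (hf : ContDiff ℝ ∞ (fun p : ℝ × ℝ => f p.1 p.2))
    (s : ℝ) : ContDiff ℝ ∞ (f s) :=
  hf.comp (contDiff_const.prodMk contDiff_id : ContDiff ℝ ∞ fun x : ℝ => (s, x))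

theorem slice_left {f : ℝ → ℝ → ℝ} (hf : ContDiff ℝ ∞ (fun p : ℝ × ℝ => f p.1 p.2))
    (x : ℝ) : ContDiff ℝ ∞ (fun s => f s x) :=
  hf.comp (contDiff_id.prodMk contDiff_const : ContDiff ℝ ∞ fun s : ℝ => (s, x))

theorem hasDerivAt_ds {f : ℝ → ℝ → ℝ}
    (hf : ContDiff ℝ ∞ (fun p : ℝ × ℝ => f p.1 p.2)) (s x : ℝ) :
    HasDerivAt (fun r => f r x) (ds f s x) s :=
  ((slice_left hf x).differentiable (by simp) s).hasDerivAt

theorem ds_eq_fderiv {f : ℝ → ℝ → ℝ}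
    (hf : ContDiff ℝ ∞ (fun p : ℝ × ℝ => f p.1 p.2)) (s x : ℝ) :
    ds f s x = fderiv ℝ (fun p : ℝ × ℝ => f p.1 p.2) (s, x) (1, 0) := by
  have h1 : HasFDerivAt (fun p : ℝ × ℝ => f p.1 p.2) _ (s, x) :=
    (hf.differentiable (by simp) (s, x)).hasFDerivAt
  have h2 : HasDerivAt (fun r : ℝ => (r, x)) ((1 : ℝ), (0 : ℝ)) s :=
    (hasDerivAt_id s).prodMk (hasDerivAt_const s x)
  exact (h1.comp_hasDerivAt s h2).deriv

theorem deriv_eq_fderiv {f : ℝ → ℝ → ℝ}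
    (hf : ContDiff ℝ ∞ (fun p : ℝ × ℝ => f p.1 p.2)) (s x : ℝ) :
    deriv (f s) x = fderiv ℝ (fun p : ℝ × ℝ => f p.1 p.2) (s, x) (0, 1) := by
  have h1 : HasFDerivAt (fun p : ℝ × ℝ => f p.1 p.2) _ (s, x) :=
    (hf.differentiable (by simp) (s, x)).hasFDerivAt
  have h2 : HasDerivAt (fun r : ℝ => (s, r)) ((0 : ℝ), (1 : ℝ)) x :=
    (hasDerivAt_const x s).prodMk (hasDerivAt_id x)
  exact (h1.comp_hasDerivAt x h2).deriv

theorem contDiff_ds {f : ℝ → ℝ → ℝ} (hf : ContDiff ℝ ∞ (fun p : ℝ × ℝ => f p.1 p.2)) :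
    ContDiff ℝ ∞ (fun p : ℝ × ℝ => ds f p.1 p.2) := by
  have h : (fun p : ℝ × ℝ => ds f p.1 p.2) =
      fun p => fderiv ℝ (fun p : ℝ × ℝ => f p.1 p.2) p (1, 0) :=
    funext fun p => ds_eq_fderiv hf p.1 p.2
  rw [h]
  exact (hf.fderiv_right (by simp)).clm_apply contDiff_const

theorem contDiff_deriv_right {f : ℝ → ℝ → ℝ}
    (hf : ContDiff ℝ ∞ (fun p : ℝ × ℝ => f p.1 p.2)) :
    ContDiff ℝ ∞ (fun p : ℝ × ℝ => deriv (f p.1) p.2) := by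
  have h : (fun p : ℝ × ℝ => deriv (f p.1) p.2) =
      fun p => fderiv ℝ (fun p : ℝ × ℝ => f p.1 p.2) p (0, 1) :=
    funext fun p => deriv_eq_fderiv hf p.1 p.2
  rw [h]
  exact (hf.fderiv_right (by simp)).clm_apply contDiff_const

/-- Both sides are values of the second Fréchet derivative on the two coordinate vectors, which is
symmetric. -/
theorem ds_deriv {f : ℝ → ℝ → ℝ} (hf : ContDiff ℝ ∞ (fun p : ℝ × ℝ => f p.1 p.2)) (s x : ℝ) :
    ds (fun s x => deriv (f s) x) s x = deriv (ds f s) x := by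
  have hd : ∀ p, DifferentiableAt ℝ (fderiv ℝ fun p : ℝ × ℝ => f p.1 p.2) p := by
    have : ContDiff ℝ ∞ (fderiv ℝ fun p : ℝ × ℝ => f p.1 p.2) := hf.fderiv_right (by simp)
    exact this.differentiable (by simp)
  have h1 : (fun p : ℝ × ℝ => ds f p.1 p.2) =
      fun p => fderiv ℝ (fun p : ℝ × ℝ => f p.1 p.2) p (1, 0) :=
    funext fun p => ds_eq_fderiv hf p.1 p.2
  have h2 : (fun p : ℝ × ℝ => deriv (f p.1) p.2) =
      fun p => fderiv ℝ (fun p : ℝ × ℝ => f p.1 p.2) p (0, 1) :=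
    funext fun p => deriv_eq_fderiv hf p.1 p.2
  rw [ds_eq_fderiv (contDiff_deriv_right hf), deriv_eq_fderiv (contDiff_ds hf), h1, h2,
    fderiv_clm_apply (hd _) (differentiableAt_const _),
    fderiv_clm_apply (hd _) (differentiableAt_const _)]
  simpa using (hf.contDiffAt.isSymmSndFDerivAt
    (by rw [minSmoothness_of_isRCLikeNormedField]
        exact WithTop.coe_le_coe.2 (le_top : (2 : ℕ∞) ≤ ⊤))).eq (1, 0) (0, 1)

theorem RFam.rtest {f : ℝ → ℝ → ℝ} (hf : RFam f) (s : ℝ) : RTest (f s) := by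
  obtain ⟨C, hC, h⟩ := hf.supp
  exact ⟨slice_right hf.smooth s, HasCompactSupport.intro hC (h s)⟩

theorem RTest.rfam {f : ℝ → ℝ} (hf : RTest f) : RFam (fun _ => f) :=
  ⟨hf.smooth.comp contDiff_snd, _, hf.supp.isCompact,
    fun _ _ hx => image_eq_zero_of_notMem_tsupport hx⟩

theorem RFam.add {f g : ℝ → ℝ → ℝ} (hf : RFam f) (hg : RFam g) :
    RFam (fun s x => f s x + g s x) := by
  obtain ⟨C, hC, h⟩ := hf.supp
  obtain ⟨D, hD, h'⟩ := hg.supp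
  refine ⟨hf.smooth.add hg.smooth, C ∪ D, hC.union hD, fun s x hx => ?_⟩
  rw [mem_union, not_or] at hx
  rw [h s x hx.1, h' s x hx.2, add_zero]

theorem RFam.mul_left {f g : ℝ → ℝ → ℝ} (hf : ContDiff ℝ ∞ (fun p : ℝ × ℝ => f p.1 p.2))
    (hg : RFam g) : RFam (fun s x => f s x * g s x) := by
  obtain ⟨D, hD, h'⟩ := hg.supp
  exact ⟨hf.mul hg.smooth, D, hD, fun s x hx => by rw [h' s x hx, mul_zero]⟩

theorem RFam.mul {f g : ℝ → ℝ → ℝ} (hf : RFam f) (hg : RFam g) :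
    RFam (fun s x => f s x * g s x) := RFam.mul_left hf.smooth hg

theorem RFam.const_mul {f : ℝ → ℝ → ℝ} (c : ℝ) (hf : RFam f) : RFam (fun s x => c * f s x) :=
  RFam.mul_left (f := fun _ _ => c) contDiff_const hf

theorem RFam.neg {f : ℝ → ℝ → ℝ} (hf : RFam f) : RFam (fun s x => -f s x) := by
  simpa using hf.const_mul (-1)

theorem RFam.sub {f g : ℝ → ℝ → ℝ} (hf : RFam f) (hg : RFam g) :
    RFam (fun s x => f s x - g s x) := by
  simpa [sub_eq_add_neg] using hf.add hg.neg

theorem RFam.smul_param {f : ℝ → ℝ} (hf : RTest f) : RFam (fun s x => s * f x) :=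
  RFam.mul_left (f := fun s _ => s) contDiff_fst hf.rfam

theorem RFam.ds {f : ℝ → ℝ → ℝ} (hf : RFam f) : RFam (ds f) := by
  obtain ⟨C, hC, h⟩ := hf.supp
  refine ⟨contDiff_ds hf.smooth, C, hC, fun s x hx => ?_⟩
  have : (fun r => f r x) = fun _ => 0 := funext fun r => h r x hx
  rw [SpacelikeCurveFlow.ds, this, deriv_const]

theorem RFam.deriv {f : ℝ → ℝ → ℝ} (hf : RFam f) : RFam (fun s x => deriv (f s) x) := by
  obtain ⟨C, hC, h⟩ := hf.supp
  refine ⟨contDiff_deriv_right hf.smooth, C, hC, fun s x hx => ?_⟩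
  have : f s =ᶠ[𝓝 x] fun _ => 0 := by
    filter_upwards [hC.isClosed.isOpen_compl.mem_nhds hx] with y hy using h s y hy
  rw [this.deriv_eq, deriv_const]

/-- The bounded weight `k` covers both uses: `k = 1` for functionals, and the translated kernel of
`D_x⁻¹` for nonlocal terms. -/
theorem RFam.hasDerivAt_integral {f : ℝ → ℝ → ℝ} (hf : RFam f) {k : ℝ → ℝ} (hk : Measurable k)
    {B : ℝ} (hB : ∀ x, |k x| ≤ B) (s : ℝ) :
    HasDerivAt (fun r => ∫ x, k x * f r x) (∫ x, k x * SpacelikeCurveFlow.ds f s x) s := by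
  obtain ⟨C, hC, h⟩ := hf.ds.supp
  have hint : ∀ {g : ℝ → ℝ}, RTest g → Integrable fun x => k x * g x := fun hg =>
    hg.integrable.bdd_mul (c := B) hk.aestronglyMeasurable (ae_of_all _ fun y => by simpa using hB y)
  -- The common compact support makes the parameter derivative bounded for all parameters within
  -- distance 1 of `s`; the dominating function is `B * M` on that support.
  obtain ⟨M, hM⟩ := ((isCompact_closedBall s 1).prod hC).exists_bound_of_continuousOn
    hf.ds.smooth.continuous.continuousOn
  refine (hasDerivAt_integral_of_dominated_loc_of_deriv_le (μ := volume)
    (bound := C.indicator fun _ => B * M) (F' := fun r x => k x * SpacelikeCurveFlow.ds f r x)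
    (Metric.closedBall_mem_nhds s one_pos) (Eventually.of_forall fun r => (hint (hf.rtest r)).1)
    (hint (hf.rtest s)) (hint (hf.ds.rtest s)).1 (ae_of_all _ fun x r hr => ?_) ?_
    (ae_of_all _ fun x r _ => ((hasDerivAt_ds hf.smooth r x).const_mul (k x)))).2
  · by_cases hx : x ∈ C
    · rw [indicator_of_mem hx, norm_mul]
      exact mul_le_mul (hB x) (hM (r, x) ⟨hr, hx⟩) (norm_nonneg _) ((abs_nonneg _).trans (hB x))
    · rw [indicator_of_notMem hx, h r x hx, mul_zero, norm_zero]
  · exact (integrable_indicator_iff hC.measurableSet).2 (integrableOn_const hC.measure_lt_top.ne)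

theorem RFam.hasDerivAt_integral_self {f : ℝ → ℝ → ℝ} (hf : RFam f) (s : ℝ) :
    HasDerivAt (fun r => ∫ x, f r x) (∫ x, SpacelikeCurveFlow.ds f s x) s := by
  simpa using hf.hasDerivAt_integral (k := fun _ => 1) measurable_const (B := 1) (by simp) s

theorem RFam.hasDerivAt_skewInv {f : ℝ → ℝ → ℝ} (hf : RFam f) (s x : ℝ) :
    HasDerivAt (fun r => skewInv (f r) x) (skewInv (SpacelikeCurveFlow.ds f s) x) s := by
  have h := hf.hasDerivAt_integral (k := fun y => skewKernel (x - y))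
    (measurable_skewKernel.comp (measurable_const.sub measurable_id)) (B := 1)
    (fun y => abs_skewKernel_le _) s
  rw [skewInv_eq_integral (hf.ds.rtest s).integrable]
  simpa only [skewInv_eq_integral (hf.rtest _).integrable] using h

/-- `D_x⁻¹` is convolution with a locally integrable kernel, so smoothness comes from the other
factor, which depends smoothly on the parameter. -/
theorem RFam.contDiff_skewInv {f : ℝ → ℝ → ℝ} (hf : RFam f) :
    ContDiff ℝ ∞ (fun p : ℝ × ℝ => skewInv (f p.1) p.2) := by
  obtain ⟨C, hC, h⟩ := hf.supp
  have key := contDiffOn_convolution_right_with_param (n := ⊤) (𝕜 := ℝ) (μ := volume)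
    (ContinuousLinearMap.mul ℝ ℝ) (g := f) (s := univ) isOpen_univ hC
    (fun p x _ hx => h p x hx) locallyIntegrable_skewKernel (hf.smooth.contDiffOn)
  rw [univ_prod_univ, contDiffOn_univ] at key
  have e : (fun p : ℝ × ℝ => skewInv (f p.1) p.2) = fun q : ℝ × ℝ =>
      convolution skewKernel (f q.1) (ContinuousLinearMap.mul ℝ ℝ) volume q.2 := by
    funext p
    rw [skewInv_eq_integral (hf.rtest _).integrable, convolution_def,
      ← integral_sub_left_eq_self _ _ p.2]
    simp
  rw [e]
  exact key

/-! ### Split-complex algebra -/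

/-- The indefinite inner product `Re (a b̄)` of split-complex numbers. -/
def ip (a b : SplitC) : ℝ := a.re * b.re - a.im * b.im

@[simp] theorem re_jj : jj.re = 0 := rfl

@[simp] theorem im_jj : jj.im = 1 := rfl

theorem re_mul_star (a b : SplitC) : (a * star b).re = ip a b := by
  simp [ip, sub_eq_add_neg]

theorem re_star_mul (a b : SplitC) : (star a * b).re = ip a b := by
  simp [ip, sub_eq_add_neg]

theorem im_mul_star (a b : SplitC) : (a * star b).im = ip (jj * a) b := by
  simp [ip]
  ring

/-- Multiplication of a field by `j`. -/
def jmul (X : ℝ → SplitC) (x : ℝ) : SplitC := jj * X x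

theorem jmul_jmul (X : ℝ → SplitC) : jmul (jmul X) = X := by
  funext x
  ext <;> simp [jmul]

theorem opI_eq_jmul (u X : ℝ → SplitC) : opI u X = jmul X := rfl

theorem opIinv_eq_jmul (u X : ℝ → SplitC) : opIinv u X = jmul X := rfl

/-- Because `Im (u w̄) = Re (j u w̄)`, the operator `H` at `u` is the operator `J` at `j u` with the
opposite sign. Every fact about `opJ` for general sign and field therefore applies to `H`. -/
theorem opH_eq_opJ (ε : ℝ) (D : (ℝ → ℝ) → ℝ → ℝ) (u w : ℝ → SplitC) :
    opH ε D u w = opJ (-ε) D (jmul u) w := by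
  funext x
  simp only [opH, opJ, im_mul_star, re_mul_star, jmul, neg_mul, neg_smul, sub_neg_eq_add]

theorem opR_eq_jmul (ε : ℝ) (D : (ℝ → ℝ) → ℝ → ℝ) (u X : ℝ → SplitC) :
    opR ε D u X = jmul (opJ ε D u X) := rfl

/-- The nonlocal scalar `D_x⁻¹ Re (v X̄)`. -/
def pin (v X : ℝ → SplitC) : ℝ → ℝ := skewInv fun y => ip (v y) (X y)

theorem opJ_apply (σ : ℝ) (v X : ℝ → SplitC) (x : ℝ) :
    opJ σ skewInv v X x = dx X x - (σ * pin v X x) • v x := by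
  simp only [opJ, re_mul_star, pin]

/-- The derivative of `v ↦ opJ σ skewInv v X` in the direction `w`. -/
def opJd (σ : ℝ) (v w X : ℝ → SplitC) (x : ℝ) : SplitC :=
  -((σ * pin v X x) • w x + (σ * pin w X x) • v x)

/-! ### Test fields -/

theorem IsTest.re {u : ℝ → SplitC} (h : IsTest u) : RTest fun x => (u x).re :=
  ⟨h.1, h.2.2.comp_left (g := QuadraticAlgebra.re) rfl⟩

theorem IsTest.im {u : ℝ → SplitC} (h : IsTest u) : RTest fun x => (u x).im :=
  ⟨h.2.1, h.2.2.comp_left (g := QuadraticAlgebra.im) rfl⟩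

theorem IsTest.of {u : ℝ → SplitC} (h1 : RTest fun x => (u x).re)
    (h2 : RTest fun x => (u x).im) : IsTest u := by
  refine ⟨h1.smooth, h2.smooth,
    HasCompactSupport.intro (h1.supp.isCompact.union h2.supp.isCompact) fun x hx => ?_⟩
  rw [mem_union, not_or] at hx
  ext
  · exact image_eq_zero_of_notMem_tsupport (f := fun x => (u x).re) hx.1
  · exact image_eq_zero_of_notMem_tsupport (f := fun x => (u x).im) hx.2

theorem IsTest.add {u v : ℝ → SplitC} (hu : IsTest u) (hv : IsTest v) : IsTest (u + v) :=
  .of (hu.re.add hv.re) (hu.im.add hv.im)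

theorem IsTest.sub {u v : ℝ → SplitC} (hu : IsTest u) (hv : IsTest v) : IsTest (u - v) :=
  .of (hu.re.sub hv.re) (hu.im.sub hv.im)

theorem IsTest.smul {u : ℝ → SplitC} (c : ℝ) (hu : IsTest u) : IsTest (c • u) :=
  .of (hu.re.const_mul c) (hu.im.const_mul c)

theorem IsTest.jmul {u : ℝ → SplitC} (hu : IsTest u) : IsTest (jmul u) :=
  .of (by simpa [SpacelikeCurveFlow.jmul] using hu.im)
    (by simpa [SpacelikeCurveFlow.jmul] using hu.re)

theorem IsTest.dx {u : ℝ → SplitC} (hu : IsTest u) : IsTest (dx u) :=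
  .of hu.re.deriv hu.im.deriv

theorem IsTest.fun_smul {u : ℝ → SplitC} {f : ℝ → ℝ} (hf : ContDiff ℝ ∞ f) (hu : IsTest u) :
    IsTest fun x => f x • u x :=
  .of (.mul_left hf hu.re) (.mul_left hf hu.im)

theorem IsTest.ip {u v : ℝ → SplitC} (hu : IsTest u) (hv : IsTest v) :
    RTest fun x => ip (u x) (v x) :=
  (hu.re.mul hv.re).sub (hu.im.mul hv.im)

theorem IsTest.contDiff_pin {u v : ℝ → SplitC} (hu : IsTest u) (hv : IsTest v) :
    ContDiff ℝ ∞ (pin u v) := (hu.ip hv).contDiff_skewInv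

theorem IsTest.hasDerivAt_pin {u v : ℝ → SplitC} (hu : IsTest u) (hv : IsTest v) (x : ℝ) :
    HasDerivAt (pin u v) (SpacelikeCurveFlow.ip (u x) (v x)) x := (hu.ip hv).hasDerivAt_skewInv x

theorem IsTest.hasDerivAt_re {u : ℝ → SplitC} (hu : IsTest u) (x : ℝ) :
    HasDerivAt (fun y => (u y).re) (SpacelikeCurveFlow.dx u x).re x := hu.re.hasDerivAt x

theorem IsTest.hasDerivAt_im {u : ℝ → SplitC} (hu : IsTest u) (x : ℝ) :
    HasDerivAt (fun y => (u y).im) (SpacelikeCurveFlow.dx u x).im x := hu.im.hasDerivAt x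

theorem IsTest.hasDerivAt_ip {u v : ℝ → SplitC} (hu : IsTest u) (hv : IsTest v) (x : ℝ) :
    HasDerivAt (fun y => SpacelikeCurveFlow.ip (u y) (v y))
      (SpacelikeCurveFlow.ip (SpacelikeCurveFlow.dx u x) (v x) +
        SpacelikeCurveFlow.ip (u x) (SpacelikeCurveFlow.dx v x)) x :=
  (((hu.hasDerivAt_re x).mul (hv.hasDerivAt_re x)).sub
    ((hu.hasDerivAt_im x).mul (hv.hasDerivAt_im x))).congr_deriv (by
      simp only [SpacelikeCurveFlow.ip]; ring)

theorem dx_eq_of_hasDerivAt {X : ℝ → SplitC} {a : SplitC} {x : ℝ}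
    (h1 : HasDerivAt (fun y => (X y).re) a.re x) (h2 : HasDerivAt (fun y => (X y).im) a.im x) :
    dx X x = a := by
  ext
  · exact h1.deriv
  · exact h2.deriv

theorem dx_jmul (X : ℝ → SplitC) : dx (jmul X) = jmul (dx X) := by
  funext x
  ext <;> simp [dx, jmul]

theorem IsTest.opJ {v X : ℝ → SplitC} (σ : ℝ) (hv : IsTest v) (hX : IsTest X) :
    IsTest (opJ σ skewInv v X) := by
  rw [show SpacelikeCurveFlow.opJ σ skewInv v X = fun x => _ from funext (opJ_apply σ v X)]
  exact hX.dx.sub (hv.fun_smul (contDiff_const.mul (hv.contDiff_pin hX)))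

theorem IsTest.opJd {v w X : ℝ → SplitC} (σ : ℝ) (hv : IsTest v) (hw : IsTest w)
    (hX : IsTest X) : IsTest (opJd σ v w X) := by
  have h := ((hw.fun_smul (contDiff_const.mul (hv.contDiff_pin hX) : ContDiff ℝ ∞
    fun x => σ * pin v X x)).add (hv.fun_smul (contDiff_const.mul (hw.contDiff_pin hX) :
      ContDiff ℝ ∞ fun x => σ * pin w X x))).smul (-1)
  convert h using 1
  funext x
  simp [SpacelikeCurveFlow.opJd, add_comm]

theorem IsTest.opR {v X : ℝ → SplitC} (ε : ℝ) (hv : IsTest v) (hX : IsTest X) :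
    IsTest (opR ε skewInv v X) := (hv.opJ ε hX).jmul

theorem pin_add_right {v X Y : ℝ → SplitC} (hv : IsTest v) (hX : IsTest X) (hY : IsTest Y) :
    pin v (X + Y) = fun x => pin v X x + pin v Y x := by
  funext x
  rw [pin, pin, pin, ← skewInv_add (hv.ip hX).integrable (hv.ip hY).integrable]
  congr 1
  funext y
  simp [ip]
  ring

theorem pin_smul_right (c : ℝ) (v X : ℝ → SplitC) :
    pin v (c • X) = fun x => c * pin v X x := by
  funext x
  rw [pin, pin, ← skewInv_const_mul]
  congr 1
  funext y
  simp [ip]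
  ring

theorem pin_comm (v X : ℝ → SplitC) : pin v X = pin X v := by
  unfold pin
  congr 1
  funext y
  simp [ip]
  ring

theorem pin_jmul (v X : ℝ → SplitC) : pin (jmul v) X = fun x => -pin v (jmul X) x := by
  funext x
  rw [pin, pin, ← skewInv_neg]
  congr 1
  funext y
  simp [ip, jmul]

theorem dx_add {X Y : ℝ → SplitC} (hX : IsTest X) (hY : IsTest Y) :
    dx (X + Y) = dx X + dx Y := by
  funext x
  exact dx_eq_of_hasDerivAt ((hX.hasDerivAt_re x).add (hY.hasDerivAt_re x))
    ((hX.hasDerivAt_im x).add (hY.hasDerivAt_im x))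

theorem dx_smul (c : ℝ) {X : ℝ → SplitC} (hX : IsTest X) : dx (c • X) = c • dx X := by
  funext x
  exact dx_eq_of_hasDerivAt ((hX.hasDerivAt_re x).const_mul c) ((hX.hasDerivAt_im x).const_mul c)

theorem opJ_add (σ : ℝ) {v X Y : ℝ → SplitC} (hv : IsTest v) (hX : IsTest X) (hY : IsTest Y) :
    opJ σ skewInv v (X + Y) = opJ σ skewInv v X + opJ σ skewInv v Y := by
  funext x
  simp only [opJ_apply, Pi.add_apply, dx_add hX hY, pin_add_right hv hX hY]
  module

theorem opJ_smul (σ c : ℝ) (v : ℝ → SplitC) {X : ℝ → SplitC} (hX : IsTest X) :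
    opJ σ skewInv v (c • X) = c • opJ σ skewInv v X := by
  funext x
  simp only [opJ_apply, Pi.smul_apply, dx_smul c hX, pin_smul_right]
  module

theorem opJ_sub (σ : ℝ) {v X Y : ℝ → SplitC} (hv : IsTest v) (hX : IsTest X) (hY : IsTest Y) :
    opJ σ skewInv v (X - Y) = opJ σ skewInv v X - opJ σ skewInv v Y := by
  rw [show X - Y = X + (-1 : ℝ) • Y by module, opJ_add σ hv hX (hY.smul _), opJ_smul σ _ _ hY]
  module

theorem jmul_add (X Y : ℝ → SplitC) : jmul (X + Y) = jmul X + jmul Y :=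
  funext fun _ => mul_add _ _ _

theorem jmul_sub (X Y : ℝ → SplitC) : jmul (X - Y) = jmul X - jmul Y :=
  funext fun _ => mul_sub _ _ _

theorem jmul_smul (c : ℝ) (X : ℝ → SplitC) : jmul (c • X) = c • jmul X :=
  funext fun x => mul_smul_comm c jj (X x)

/-! ### The pairing -/

theorem pairing_eq (ξ X : ℝ → SplitC) : pairing ξ X = ∫ x, ip (ξ x) (X x) := by
  simp only [pairing, re_star_mul]

theorem pairing_comm (X Y : ℝ → SplitC) : pairing X Y = pairing Y X := by
  rw [pairing_eq, pairing_eq]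
  congr 1
  funext y
  simp [ip]
  ring

theorem pairing_add_left {X Y Z : ℝ → SplitC} (hX : IsTest X) (hY : IsTest Y) (hZ : IsTest Z) :
    pairing (X + Y) Z = pairing X Z + pairing Y Z := by
  rw [pairing_eq, pairing_eq, pairing_eq, ← integral_add (hX.ip hZ).integrable
    (hY.ip hZ).integrable]
  congr 1
  funext y
  simp [ip]
  ring

theorem pairing_smul_left (c : ℝ) (X Z : ℝ → SplitC) :
    pairing (c • X) Z = c * pairing X Z := by
  rw [pairing_eq, pairing_eq, ← integral_const_mul]
  congr 1
  funext y
  simp [ip]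
  ring

theorem pairing_add_right {X Y Z : ℝ → SplitC} (hX : IsTest X) (hY : IsTest Y) (hZ : IsTest Z) :
    pairing X (Y + Z) = pairing X Y + pairing X Z := by
  rw [pairing_comm, pairing_add_left hY hZ hX, pairing_comm Y, pairing_comm Z]

theorem pairing_smul_right (c : ℝ) (X Z : ℝ → SplitC) :
    pairing X (c • Z) = c * pairing X Z := by
  rw [pairing_comm, pairing_smul_left, pairing_comm]

theorem pairing_jmul (X Y : ℝ → SplitC) : pairing (jmul X) Y = -pairing X (jmul Y) := by
  rw [pairing_eq, pairing_eq, ← integral_neg]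
  congr 1
  funext y
  simp [ip, jmul]

/-- Both `D_x` and `v D_x⁻¹ Re (v C)` are skew: the first by parts, the second because `D_x⁻¹` is
skew and lies between multiplication by `v` and its adjoint. -/
theorem pairing_opJ_skew (σ : ℝ) {v X Y : ℝ → SplitC} (hv : IsTest v) (hX : IsTest X)
    (hY : IsTest Y) :
    pairing (opJ σ skewInv v X) Y = -pairing X (opJ σ skewInv v Y) := by
  have h1 : ∫ x, (ip (dx X x) (Y x) + ip (X x) (dx Y x)) = 0 :=
    integral_eq_zero_of_hasDerivAt (hX.ip hY) (hX.hasDerivAt_ip hY)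
  rw [integral_add (hX.dx.ip hY).integrable (hX.ip hY.dx).integrable] at h1
  have h2 := integral_mul_skewInv (hv.ip hX) (hv.ip hY)
  have i1 := ((hv.ip hY).mul_right (hv.ip hX).contDiff_skewInv).integrable.const_mul σ
  have i2 := ((hv.ip hX).mul_right (hv.ip hY).contDiff_skewInv).integrable.const_mul σ
  have e1 : pairing (opJ σ skewInv v X) Y = (∫ x, ip (dx X x) (Y x)) -
      σ * ∫ x, ip (v x) (Y x) * skewInv (fun y => ip (v y) (X y)) x := by
    rw [pairing_eq, ← integral_const_mul, ← integral_sub (hX.dx.ip hY).integrable i1]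
    congr 1
    funext x
    simp [opJ_apply, ip, pin]
    ring
  have e2 : pairing X (opJ σ skewInv v Y) = (∫ x, ip (X x) (dx Y x)) -
      σ * ∫ x, ip (v x) (X x) * skewInv (fun y => ip (v y) (Y y)) x := by
    rw [pairing_eq, ← integral_const_mul, ← integral_sub (hX.ip hY.dx).integrable i2]
    congr 1
    funext x
    simp [opJ_apply, ip, pin]
    ring
  rw [e1, e2, h2]
  linear_combination h1

/-- The trilinear form that represents the derivative of `opJ`. -/
def trip (v w X Y : ℝ → SplitC) : ℝ :=
  ∫ x, (ip (w x) (Y x) * pin v X x - ip (w x) (X x) * pin v Y x)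

theorem IsTest.ip_mul_pin {v w X Y : ℝ → SplitC} (hv : IsTest v) (hw : IsTest w) (hX : IsTest X)
    (hY : IsTest Y) : RTest fun x => SpacelikeCurveFlow.ip (w x) (Y x) * pin v X x :=
  (hw.ip hY).mul_right (hv.contDiff_pin hX)

theorem IsTest.trip_integrand {v w X Y : ℝ → SplitC} (hv : IsTest v) (hw : IsTest w)
    (hX : IsTest X) (hY : IsTest Y) :
    RTest fun x => SpacelikeCurveFlow.ip (w x) (Y x) * pin v X x -
      SpacelikeCurveFlow.ip (w x) (X x) * pin v Y x :=
  (hv.ip_mul_pin hw hX hY).sub (hv.ip_mul_pin hw hY hX)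

/-- Skew-adjointness of `D_x⁻¹` moves the antiderivative in the second term of `opJd` off `w`,
leaving only antiderivatives that involve `v`. The result is antisymmetric in `X`, `Y` and local in
`w`, which is the form the cyclic identities need. -/
theorem pairing_opJd (σ : ℝ) {v w X Y : ℝ → SplitC} (hv : IsTest v) (hw : IsTest w)
    (hX : IsTest X) (hY : IsTest Y) :
    pairing (opJd σ v w X) Y = -σ * trip v w X Y := by
  have h2 := integral_mul_skewInv (hw.ip hX) (hv.ip hY)
  have i1 := (hv.ip_mul_pin hw hX hY).integrable
  have i2 := (hw.ip_mul_pin hv hX hY).integrable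
  have i3 := (hv.ip_mul_pin hw hY hX).integrable
  have e1 : pairing (opJd σ v w X) Y = -σ * ((∫ x, ip (w x) (Y x) * pin v X x) +
      ∫ x, ip (v x) (Y x) * pin w X x) := by
    rw [pairing_eq, ← integral_add i1 i2, ← integral_const_mul]
    congr 1
    funext x
    simp [opJd, ip]
    ring
  rw [e1, trip, integral_sub i1 i3]
  simp only [pin] at *
  rw [h2]
  ring

theorem trip_add {v w w' X Y : ℝ → SplitC} (hv : IsTest v) (hw : IsTest w) (hw' : IsTest w')
    (hX : IsTest X) (hY : IsTest Y) : trip v (w + w') X Y = trip v w X Y + trip v w' X Y := by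
  rw [trip, trip, trip, ← integral_add (hv.trip_integrand hw hX hY).integrable
    (hv.trip_integrand hw' hX hY).integrable]
  congr 1
  funext x
  simp [ip]
  ring

theorem trip_smul (c : ℝ) (v w X Y : ℝ → SplitC) : trip v (c • w) X Y = c * trip v w X Y := by
  rw [trip, trip, ← integral_const_mul]
  congr 1
  funext x
  simp [ip]
  ring

/-! ### Families of fields -/

/-- Smooth families of split-complex fields with a common compact support. -/
structure Fam (Y : ℝ → ℝ → SplitC) : Prop where
  re : RFam fun s x => (Y s x).re
  im : RFam fun s x => (Y s x).im

/-- The derivative of a family of fields with respect to the parameter. -/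
def dS (Y : ℝ → ℝ → SplitC) (s x : ℝ) : SplitC :=
  ⟨ds (fun s x => (Y s x).re) s x, ds (fun s x => (Y s x).im) s x⟩

theorem vder_eq_dS (K : (ℝ → SplitC) → ℝ → SplitC) (u w : ℝ → SplitC) :
    vder K u w = dS (fun s => K (u + s • w)) 0 := rfl

theorem Fam.test {Y : ℝ → ℝ → SplitC} (hY : Fam Y) (s : ℝ) : IsTest (Y s) :=
  .of (hY.re.rtest s) (hY.im.rtest s)

theorem IsTest.fam {X : ℝ → SplitC} (hX : IsTest X) : Fam fun _ => X :=
  ⟨hX.re.rfam, hX.im.rfam⟩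

theorem Fam.dS {Y : ℝ → ℝ → SplitC} (hY : Fam Y) : Fam (dS Y) := ⟨hY.re.ds, hY.im.ds⟩

theorem Fam.add {Y Z : ℝ → ℝ → SplitC} (hY : Fam Y) (hZ : Fam Z) : Fam fun s => Y s + Z s :=
  ⟨hY.re.add hZ.re, hY.im.add hZ.im⟩

theorem Fam.smul {Y : ℝ → ℝ → SplitC} (c : ℝ) (hY : Fam Y) : Fam fun s => c • Y s :=
  ⟨hY.re.const_mul c, hY.im.const_mul c⟩

theorem Fam.jmul {Y : ℝ → ℝ → SplitC} (hY : Fam Y) : Fam fun s => jmul (Y s) :=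
  ⟨by simpa [SpacelikeCurveFlow.jmul] using hY.im,
    by simpa [SpacelikeCurveFlow.jmul] using hY.re⟩

theorem IsTest.fam_line {u w : ℝ → SplitC} (hu : IsTest u) (hw : IsTest w) :
    Fam fun s => u + s • w :=
  hu.fam.add (Z := fun s => s • w) ⟨.smul_param hw.re, .smul_param hw.im⟩

theorem Fam.hasDerivAt_re {Y : ℝ → ℝ → SplitC} (hY : Fam Y) (s x : ℝ) :
    HasDerivAt (fun r => (Y r x).re) (SpacelikeCurveFlow.dS Y s x).re s :=
  hasDerivAt_ds (f := fun s x => (Y s x).re) hY.re.smooth s x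

theorem Fam.hasDerivAt_im {Y : ℝ → ℝ → SplitC} (hY : Fam Y) (s x : ℝ) :
    HasDerivAt (fun r => (Y r x).im) (SpacelikeCurveFlow.dS Y s x).im s :=
  hasDerivAt_ds (f := fun s x => (Y s x).im) hY.im.smooth s x

theorem dS_eq_of_hasDerivAt {Y : ℝ → ℝ → SplitC} {a : SplitC} {s x : ℝ}
    (h1 : HasDerivAt (fun r => (Y r x).re) a.re s)
    (h2 : HasDerivAt (fun r => (Y r x).im) a.im s) : dS Y s x = a := by
  ext
  · exact h1.deriv
  · exact h2.deriv

theorem dS_line (u w : ℝ → SplitC) (s : ℝ) : dS (fun s => u + s • w) s = w := by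
  funext x
  refine dS_eq_of_hasDerivAt ?_ ?_
  · simpa using ((hasDerivAt_id s).mul_const (w x).re).const_add (u x).re
  · simpa using ((hasDerivAt_id s).mul_const (w x).im).const_add (u x).im

theorem dS_const (X : ℝ → SplitC) (s : ℝ) : dS (fun _ => X) s = 0 := by
  funext x
  exact dS_eq_of_hasDerivAt (hasDerivAt_const _ _) (hasDerivAt_const _ _)

theorem dS_jmul (Y : ℝ → ℝ → SplitC) (s : ℝ) :
    dS (fun s => jmul (Y s)) s = jmul (dS Y s) := by
  funext x
  ext <;> simp [dS, jmul, ds]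

theorem dS_add {Y Z : ℝ → ℝ → SplitC} (hY : Fam Y) (hZ : Fam Z) (s : ℝ) :
    dS (fun s => Y s + Z s) s = dS Y s + dS Z s := by
  funext x
  exact dS_eq_of_hasDerivAt ((hY.hasDerivAt_re s x).add (hZ.hasDerivAt_re s x))
    ((hY.hasDerivAt_im s x).add (hZ.hasDerivAt_im s x))

theorem dS_smul (c : ℝ) {Y : ℝ → ℝ → SplitC} (hY : Fam Y) (s : ℝ) :
    dS (fun s => c • Y s) s = c • dS Y s := by
  funext x
  exact dS_eq_of_hasDerivAt ((hY.hasDerivAt_re s x).const_mul c)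
    ((hY.hasDerivAt_im s x).const_mul c)

theorem Fam.vDiff {K : (ℝ → SplitC) → ℝ → SplitC} {u w : ℝ → SplitC}
    (h : Fam fun s => K (u + s • w)) : VDiff K u w := fun x =>
  ⟨(h.hasDerivAt_re 0 x).differentiableAt, (h.hasDerivAt_im 0 x).differentiableAt⟩

theorem Fam.ip {Y Z : ℝ → ℝ → SplitC} (hY : Fam Y) (hZ : Fam Z) :
    RFam fun s x => ip (Y s x) (Z s x) :=
  (hY.re.mul hZ.re).sub (hY.im.mul hZ.im)

theorem Fam.ds_ip {Y Z : ℝ → ℝ → SplitC} (hY : Fam Y) (hZ : Fam Z) (s x : ℝ) :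
    ds (fun s x => SpacelikeCurveFlow.ip (Y s x) (Z s x)) s x =
      SpacelikeCurveFlow.ip (SpacelikeCurveFlow.dS Y s x) (Z s x) +
        SpacelikeCurveFlow.ip (Y s x) (SpacelikeCurveFlow.dS Z s x) :=
  ((((hY.hasDerivAt_re s x).mul (hZ.hasDerivAt_re s x)).sub
    ((hY.hasDerivAt_im s x).mul (hZ.hasDerivAt_im s x))).congr_deriv (by
      simp only [SpacelikeCurveFlow.ip]; ring)).deriv

theorem Fam.hasDerivAt_pin {U Y : ℝ → ℝ → SplitC} (hU : Fam U) (hY : Fam Y) (s x : ℝ) :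
    HasDerivAt (fun r => pin (U r) (Y r) x)
      (pin (SpacelikeCurveFlow.dS U s) (Y s) x + pin (U s) (SpacelikeCurveFlow.dS Y s) x) s := by
  have h := (hU.ip hY).hasDerivAt_skewInv s x
  rw [show ds (fun s x => SpacelikeCurveFlow.ip (U s x) (Y s x)) s = fun x => _ from
    funext (hU.ds_ip hY s), skewInv_add ((hU.dS.test s).ip (hY.test s)).integrable
      ((hU.test s).ip (hY.dS.test s)).integrable] at h
  exact h

theorem Fam.hasDerivAt_pairing {Y Z : ℝ → ℝ → SplitC} (hY : Fam Y) (hZ : Fam Z) (s : ℝ) :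
    HasDerivAt (fun r => pairing (Y r) (Z r))
      (pairing (SpacelikeCurveFlow.dS Y s) (Z s) + pairing (Y s) (SpacelikeCurveFlow.dS Z s))
      s := by
  have h := (hY.ip hZ).hasDerivAt_integral_self s
  rw [show ds (fun s x => SpacelikeCurveFlow.ip (Y s x) (Z s x)) s = fun x => _ from
    funext (hY.ds_ip hZ s), integral_add ((hY.dS.test s).ip (hZ.test s)).integrable
      ((hY.test s).ip (hZ.dS.test s)).integrable] at h
  simpa only [pairing_eq] using h

/-- The nonlocal scalar is jointly smooth but not compactly supported; the factor `U` in front of it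
restores the common compact support. -/
theorem Fam.opJ {U Y : ℝ → ℝ → SplitC} (σ : ℝ) (hU : Fam U) (hY : Fam Y) :
    Fam fun s => opJ σ skewInv (U s) (Y s) := by
  have hp : ContDiff ℝ ∞ fun p : ℝ × ℝ => σ * pin (U p.1) (Y p.1) p.2 :=
    contDiff_const.mul (hU.ip hY).contDiff_skewInv
  refine ⟨?_, ?_⟩
  · simpa [opJ_apply, dx] using hY.re.deriv.sub
      (.mul_left (f := fun s x => σ * pin (U s) (Y s) x) hp hU.re)
  · simpa [opJ_apply, dx] using hY.im.deriv.sub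
      (.mul_left (f := fun s x => σ * pin (U s) (Y s) x) hp hU.im)

theorem dS_opJ {U Y : ℝ → ℝ → SplitC} (σ : ℝ) (hU : Fam U) (hY : Fam Y) (s : ℝ) :
    dS (fun s => opJ σ skewInv (U s) (Y s)) s =
      opJ σ skewInv (U s) (dS Y s) + opJd σ (U s) (dS U s) (Y s) := by
  funext x
  have hp := (hU.hasDerivAt_pin hY s x).const_mul σ
  have h1 := hasDerivAt_ds (f := fun s x => deriv (fun y => (Y s y).re) x) hY.re.deriv.smooth s x
  have h2 := hasDerivAt_ds (f := fun s x => deriv (fun y => (Y s y).im) x) hY.im.deriv.smooth s x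
  rw [ds_deriv (f := fun s x => (Y s x).re) hY.re.smooth] at h1
  rw [ds_deriv (f := fun s x => (Y s x).im) hY.im.smooth] at h2
  refine dS_eq_of_hasDerivAt ?_ ?_
  · have h := h1.sub (hp.mul (hU.hasDerivAt_re s x))
    simp only [opJ_apply]
    refine h.congr_deriv ?_
    simp [opJ_apply, opJd, dx, dS]
    ring
  · have h := h2.sub (hp.mul (hU.hasDerivAt_im s x))
    simp only [opJ_apply]
    refine h.congr_deriv ?_
    simp [opJ_apply, opJd, dx, dS]
    ring

theorem opDer_opJ (σ : ℝ) {u w X : ℝ → SplitC} (hu : IsTest u) (hw : IsTest w) (hX : IsTest X) :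
    opDer (opJ σ skewInv) u w X = opJd σ u w X := by
  have h := dS_opJ σ (hu.fam_line hw) hX.fam 0
  rw [dS_line, dS_const] at h
  rw [opDer, vder_eq_dS, h, show (0 : ℝ → SplitC) = (0 : ℝ) • X by simp, opJ_smul σ _ _ hX]
  simp

/-! ### Cyclic identities -/

theorem IsTest.pin_mul_ip {v X A B : ℝ → SplitC} (hv : IsTest v) (hX : IsTest X) (hA : IsTest A)
    (hB : IsTest B) : RTest fun x => pin v X x * SpacelikeCurveFlow.ip (A x) (B x) :=
  .mul_left (hv.contDiff_pin hX) (hA.ip hB)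

theorem IsTest.hasDerivAt_pin_mul_ip {v X A B : ℝ → SplitC} (hv : IsTest v) (hX : IsTest X)
    (hA : IsTest A) (hB : IsTest B) (x : ℝ) :
    HasDerivAt (fun x => pin v X x * SpacelikeCurveFlow.ip (A x) (B x))
      (SpacelikeCurveFlow.ip (v x) (X x) * SpacelikeCurveFlow.ip (A x) (B x) +
        pin v X x * (SpacelikeCurveFlow.ip (SpacelikeCurveFlow.dx A x) (B x) +
          SpacelikeCurveFlow.ip (A x) (SpacelikeCurveFlow.dx B x))) x :=
  (hv.hasDerivAt_pin hX x).mul (hA.hasDerivAt_ip hB x)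

/-- The integrands cancel pointwise, in pairs, by symmetry of `ip`. -/
theorem trip_cyclic {v X Y Z : ℝ → SplitC} (hv : IsTest v) (hX : IsTest X) (hY : IsTest Y)
    (hZ : IsTest Z) : trip v Z X Y + trip v X Y Z + trip v Y Z X = 0 := by
  rw [trip, trip, trip, ← integral_add (hv.trip_integrand hZ hX hY).integrable
      (hv.trip_integrand hX hY hZ).integrable,
    ← integral_add ((hv.trip_integrand hZ hX hY).add (hv.trip_integrand hX hY hZ)).integrable
      (hv.trip_integrand hY hZ hX).integrable]
  rw [← integral_zero ℝ ℝ]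
  congr 1
  funext x
  simp only [ip]
  ring

/-- The integrand is a total derivative. Terms quadratic in the nonlocal scalars cancel cyclically,
terms linear in them match by antisymmetry of `ip (j a) b`, and the purely local remainder `ip v X *
ip (j Z) Y` + cyclic vanishes because it is alternating in three vectors of a plane. -/
theorem trip_cyclic_jmul_opJ (σ : ℝ) {v X Y Z : ℝ → SplitC} (hv : IsTest v) (hX : IsTest X)
    (hY : IsTest Y) (hZ : IsTest Z) :
    trip v (jmul (opJ σ skewInv v Z)) X Y + trip v (jmul (opJ σ skewInv v X)) Y Z +
      trip v (jmul (opJ σ skewInv v Y)) Z X = 0 := by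
  have i1 := hv.trip_integrand (hv.opJ σ hZ).jmul hX hY
  have i2 := hv.trip_integrand (hv.opJ σ hX).jmul hY hZ
  have i3 := hv.trip_integrand (hv.opJ σ hY).jmul hZ hX
  rw [trip, trip, trip, ← integral_add i1.integrable i2.integrable,
    ← integral_add (i1.add i2).integrable i3.integrable]
  refine integral_eq_zero_of_hasDerivAt
    (((hv.pin_mul_ip hX hZ.jmul hY).add (hv.pin_mul_ip hY hX.jmul hZ)).add
      (hv.pin_mul_ip hZ hY.jmul hX)) fun x => ?_
  refine (((hv.hasDerivAt_pin_mul_ip hX hZ.jmul hY x).add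
    (hv.hasDerivAt_pin_mul_ip hY hX.jmul hZ x)).add
      (hv.hasDerivAt_pin_mul_ip hZ hY.jmul hX x)).congr_deriv ?_
  simp [dx_jmul, ip, jmul, opJ_apply]
  ring

/-- The interaction of `H` with `J⁻¹`: the variation of `J` along `H J` balances the variation of
`H` along the identity. It cancels the terms with coefficient `c₁ c₂ a` in the Jacobi identity of
the quotient. -/
theorem trip_cyclic_opJ_opJ (ε : ℝ) {u X Y Z : ℝ → SplitC} (hu : IsTest u) (hX : IsTest X)
    (hY : IsTest Y) (hZ : IsTest Z) :
    trip u (opJ (-ε) skewInv (jmul u) (opJ ε skewInv u Z)) X Y +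
      trip u (opJ (-ε) skewInv (jmul u) (opJ ε skewInv u X)) Y Z +
      trip u (opJ (-ε) skewInv (jmul u) (opJ ε skewInv u Y)) Z X =
    trip (jmul u) (jmul Z) (opJ ε skewInv u X) (opJ ε skewInv u Y) +
      trip (jmul u) (jmul X) (opJ ε skewInv u Y) (opJ ε skewInv u Z) +
      trip (jmul u) (jmul Y) (opJ ε skewInv u Z) (opJ ε skewInv u X) := by
  have hKX := hu.opJ ε hX
  have hKY := hu.opJ ε hY
  have hKZ := hu.opJ ε hZ
  have eX : ∀ x, opJ ε skewInv u X x = _ := opJ_apply ε u X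
  have eY : ∀ x, opJ ε skewInv u Y x = _ := opJ_apply ε u Y
  have eZ : ∀ x, opJ ε skewInv u Z x = _ := opJ_apply ε u Z
  -- The inner values of `J` become atoms, so that unfolding `opJ_apply` reaches only the outer
  -- operator; `eX`, `eY`, `eZ` expand them pointwise afterwards.
  generalize opJ ε skewInv u X = KX at *
  generalize opJ ε skewInv u Y = KY at *
  generalize opJ ε skewInv u Z = KZ at *
  have i1 := hu.trip_integrand (hu.jmul.opJ (-ε) hKZ) hX hY
  have i2 := hu.trip_integrand (hu.jmul.opJ (-ε) hKX) hY hZ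
  have i3 := hu.trip_integrand (hu.jmul.opJ (-ε) hKY) hZ hX
  have j1 := hu.jmul.trip_integrand hZ.jmul hKX hKY
  have j2 := hu.jmul.trip_integrand hX.jmul hKY hKZ
  have j3 := hu.jmul.trip_integrand hY.jmul hKZ hKX
  simp only [trip]
  rw [← integral_add i1.integrable i2.integrable,
    ← integral_add (i1.add i2).integrable i3.integrable, ← integral_add j1.integrable j2.integrable,
    ← integral_add (j1.add j2).integrable j3.integrable, ← sub_eq_zero,
    ← integral_sub ((i1.add i2).add i3).integrable ((j1.add j2).add j3).integrable]
  -- The primitive has three terms for each of `X`, `Y`, `Z`: two carry the nonlocal scalar of `J`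
  -- at `u`, one carries that of `H`, which is built on `j u` and the value of `J`.
  refine integral_eq_zero_of_hasDerivAt
    ((((hu.pin_mul_ip hX hKZ hY).sub (hu.pin_mul_ip hX hKY hZ)).sub
      (hu.jmul.pin_mul_ip hKX hZ.jmul hY)).add
    ((((hu.pin_mul_ip hY hKX hZ).sub (hu.pin_mul_ip hY hKZ hX)).sub
      (hu.jmul.pin_mul_ip hKY hX.jmul hZ)).add
    (((hu.pin_mul_ip hZ hKY hX).sub (hu.pin_mul_ip hZ hKX hY)).sub
      (hu.jmul.pin_mul_ip hKZ hY.jmul hX)))) fun x => ?_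
  refine ((((hu.hasDerivAt_pin_mul_ip hX hKZ hY x).sub (hu.hasDerivAt_pin_mul_ip hX hKY hZ x)).sub
      (hu.jmul.hasDerivAt_pin_mul_ip hKX hZ.jmul hY x)).add
    ((((hu.hasDerivAt_pin_mul_ip hY hKX hZ x).sub (hu.hasDerivAt_pin_mul_ip hY hKZ hX x)).sub
      (hu.jmul.hasDerivAt_pin_mul_ip hKY hX.jmul hZ x)).add
    (((hu.hasDerivAt_pin_mul_ip hZ hKY hX x).sub (hu.hasDerivAt_pin_mul_ip hZ hKX hY x)).sub
      (hu.jmul.hasDerivAt_pin_mul_ip hKZ hY.jmul hX x)))).congr_deriv ?_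
  simp only [opJ_apply, dx_jmul, ip, jmul, QuadraticAlgebra.re_mul, QuadraticAlgebra.im_mul, re_jj,
    im_jj, QuadraticAlgebra.re_sub, QuadraticAlgebra.im_sub, QuadraticAlgebra.re_smul,
    QuadraticAlgebra.im_smul, smul_eq_mul]
  simp only [eX, eY, eZ, QuadraticAlgebra.re_sub, QuadraticAlgebra.im_sub,
    QuadraticAlgebra.re_smul, QuadraticAlgebra.im_smul, smul_eq_mul]
  ring

/-! ### The pencil of operators `a H + b I` -/

/-- The pencil `a H + b I`. -/
def pencil (ε a b : ℝ) : FieldOp := linComb a b (opH ε skewInv) opI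

theorem pencil_eq (ε a b : ℝ) (u X : ℝ → SplitC) :
    pencil ε a b u X = a • opJ (-ε) skewInv (jmul u) X + b • jmul X := by
  rw [pencil, linComb, opH_eq_opJ, opI_eq_jmul]

theorem pencil_one_zero (ε : ℝ) : pencil ε 1 0 = opH ε skewInv := by
  funext u X
  simp [pencil, linComb]

theorem pencil_zero_one (ε : ℝ) : pencil ε 0 1 = opI := by
  funext u X
  simp [pencil, linComb]

theorem IsTest.pencil {u X : ℝ → SplitC} (ε a b : ℝ) (hu : IsTest u) (hX : IsTest X) :
    IsTest (pencil ε a b u X) := by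
  rw [pencil_eq]
  exact ((hu.jmul.opJ _ hX).smul a).add (hX.jmul.smul b)

theorem pencil_add (ε a b : ℝ) {u X Y : ℝ → SplitC} (hu : IsTest u) (hX : IsTest X)
    (hY : IsTest Y) : pencil ε a b u (X + Y) = pencil ε a b u X + pencil ε a b u Y := by
  rw [pencil_eq, pencil_eq, pencil_eq, opJ_add _ hu.jmul hX hY, jmul_add]
  module

theorem pencil_smul (ε a b c : ℝ) (u : ℝ → SplitC) {X : ℝ → SplitC} (hX : IsTest X) :
    pencil ε a b u (c • X) = c • pencil ε a b u X := by
  rw [pencil_eq, pencil_eq, opJ_smul _ _ _ hX, jmul_smul]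
  module

theorem pairing_pencil_skew (ε a b : ℝ) {u X Y : ℝ → SplitC} (hu : IsTest u) (hX : IsTest X)
    (hY : IsTest Y) : pairing (pencil ε a b u X) Y = -pairing X (pencil ε a b u Y) := by
  have h1 := hu.jmul.opJ (-ε) hX
  have h2 := hu.jmul.opJ (-ε) hY
  rw [pencil_eq, pencil_eq, pairing_add_left (h1.smul a) (hX.jmul.smul b) hY,
    pairing_add_right hX (h2.smul a) (hY.jmul.smul b)]
  simp only [pairing_smul_left, pairing_smul_right]
  rw [pairing_opJ_skew _ hu.jmul hX hY, pairing_jmul]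
  ring

theorem Fam.pencil {U Y : ℝ → ℝ → SplitC} (ε a b : ℝ) (hU : Fam U) (hY : Fam Y) :
    Fam fun s => pencil ε a b (U s) (Y s) := by
  simp only [pencil_eq]
  exact ((hU.jmul.opJ _ hY).smul a).add (hY.jmul.smul b)

theorem dS_pencil {U Y : ℝ → ℝ → SplitC} (ε a b : ℝ) (hU : Fam U) (hY : Fam Y) (s : ℝ) :
    dS (fun s => pencil ε a b (U s) (Y s)) s = pencil ε a b (U s) (dS Y s) +
      a • opJd (-ε) (jmul (U s)) (jmul (dS U s)) (Y s) := by
  simp only [pencil_eq]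
  rw [dS_add ((hU.jmul.opJ _ hY).smul a) (hY.jmul.smul b), dS_smul _ (hU.jmul.opJ _ hY),
    dS_smul _ hY.jmul, dS_opJ _ hU.jmul hY, dS_jmul, dS_jmul]
  module

/-- Jacobi identity of the pencil in trivector form. It is linear in `(a, b)`: the `H` part is the
total-derivative identity at `j u`, and since `j² = 1` the `I` part is the pointwise one. -/
theorem trip_cyclic_pencil (ε a b : ℝ) {u X Y Z : ℝ → SplitC} (hu : IsTest u) (hX : IsTest X)
    (hY : IsTest Y) (hZ : IsTest Z) :
    trip (jmul u) (jmul (pencil ε a b u Z)) X Y + trip (jmul u) (jmul (pencil ε a b u X)) Y Z +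
      trip (jmul u) (jmul (pencil ε a b u Y)) Z X = 0 := by
  have e : ∀ W A B, IsTest W → IsTest A → IsTest B →
      trip (jmul u) (jmul (pencil ε a b u W)) A B =
        a * trip (jmul u) (jmul (opJ (-ε) skewInv (jmul u) W)) A B + b * trip (jmul u) W A B :=
    fun W A B hW hA hB => by
      rw [pencil_eq, jmul_add, jmul_smul, jmul_smul, jmul_jmul,
        trip_add hu.jmul ((hu.jmul.opJ _ hW).jmul.smul a) (hW.smul b) hA hB, trip_smul, trip_smul]
  rw [e Z X Y hZ hX hY, e X Y Z hX hY hZ, e Y Z X hY hZ hX]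
  linear_combination a * trip_cyclic_jmul_opJ (-ε) hu.jmul hX hY hZ +
    b * trip_cyclic hu.jmul hX hY hZ

/-- Preserving smooth families contains both requirements: constant families give the mapping
property, and lines `u + s • w` give differentiability in `u`. -/
theorem isFieldOp_of_fam {D : FieldOp} (hD : ∀ {U Y}, Fam U → Fam Y → Fam fun s => D (U s) (Y s))
    (hl : ∀ u X Y, IsTest u → IsTest X → IsTest Y → ∀ a : ℝ, D u (a • X + Y) = a • D u X + D u Y) :
    IsFieldOp D where
  maps _ _ hu hX := (hD hu.fam hX.fam).test 0
  linear := hl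
  diff _ _ _ hu hw hX := (hD (hu.fam_line hw) hX.fam).vDiff

theorem isFieldOp_opJ (σ : ℝ) : IsFieldOp (opJ σ skewInv) :=
  isFieldOp_of_fam (fun hU hY => hU.opJ σ hY) fun u X Y hu hX hY a => by
    rw [opJ_add σ hu (hX.smul a) hY, opJ_smul σ a u hX]

theorem isFieldOp_pencil (ε a b : ℝ) : IsFieldOp (pencil ε a b) :=
  isFieldOp_of_fam (fun hU hY => hU.pencil ε a b hY) fun u X Y hu hX hY c => by
    rw [pencil_add ε a b hu (hX.smul c) hY, pencil_smul ε a b c u hX]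

/-! ### The symplectic operator and its compatibility with the pencil -/

theorem isSymplectic_opJ (σ : ℝ) : IsSymplectic (opJ σ skewInv) where
  op := isFieldOp_opJ σ
  skew u X Y hu hX hY := by
    rw [pairing_opJ_skew σ hu hX hY, pairing_comm X]
    ring
  closed u X Y Z hu hX hY hZ := by
    rw [opDer_opJ σ hu hX hY, opDer_opJ σ hu hY hZ, opDer_opJ σ hu hZ hX,
      pairing_opJd σ hu hX hY hZ, pairing_opJd σ hu hY hZ hX, pairing_opJd σ hu hZ hX hY]
    linear_combination -σ * trip_cyclic hu hX hY hZ

/-- The numerator `c₁ D J + c₂` of the quotient `c₁ D + c₂ J⁻¹`, for `D` in the pencil. -/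
def quotNum (ε a b c₁ c₂ : ℝ) : FieldOp :=
  linComb c₁ c₂ (opComp (pencil ε a b) (opJ ε skewInv)) (fun _ X => X)

theorem quotNum_eq (ε a b c₁ c₂ : ℝ) (u X : ℝ → SplitC) :
    quotNum ε a b c₁ c₂ u X = c₁ • pencil ε a b u (opJ ε skewInv u X) + c₂ • X := rfl

theorem IsTest.quotNum {u X : ℝ → SplitC} (ε a b c₁ c₂ : ℝ) (hu : IsTest u) (hX : IsTest X) :
    IsTest (quotNum ε a b c₁ c₂ u X) :=
  ((hu.pencil ε a b (hu.opJ ε hX)).smul c₁).add (hX.smul c₂)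

theorem isFieldOp_quotNum (ε a b c₁ c₂ : ℝ) : IsFieldOp (quotNum ε a b c₁ c₂) :=
  isFieldOp_of_fam
    (fun hU hY => ((hU.pencil ε a b (hU.opJ ε hY)).smul c₁).add (hY.smul c₂))
    fun u X Y hu hX hY c => by
      have h := hu.opJ ε hX
      rw [quotNum_eq, quotNum_eq, quotNum_eq, opJ_add ε hu (hX.smul c) hY, opJ_smul ε c u hX,
        pencil_add ε a b hu (h.smul c) (hu.opJ ε hY), pencil_smul ε a b c u h]
      module

theorem opDer_quotNum (ε a b c₁ c₂ : ℝ) {u w X : ℝ → SplitC} (hu : IsTest u) (hw : IsTest w)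
    (hX : IsTest X) :
    opDer (quotNum ε a b c₁ c₂) u w X = c₁ • pencil ε a b u (opJd ε u w X) +
      (c₁ * a) • opJd (-ε) (jmul u) (jmul w) (opJ ε skewInv u X) := by
  have hU := hu.fam_line hw
  have hJ := hU.opJ ε hX.fam
  have h0 : opJ ε skewInv u (0 : ℝ → SplitC) = 0 := by
    rw [← zero_smul ℝ X, opJ_smul ε _ _ hX, zero_smul, zero_smul]
  have h := dS_add ((hU.pencil ε a b hJ).smul c₁) (hX.fam.smul c₂) 0
  rw [dS_smul _ (hU.pencil ε a b hJ), dS_smul _ hX.fam, dS_const, dS_pencil ε a b hU hJ,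
    dS_opJ ε hU hX.fam, dS_line, dS_const] at h
  simp only [zero_smul, add_zero, h0, zero_add, smul_zero] at h
  rw [opDer, vder_eq_dS]
  refine h.trans ?_
  module

/-- With `D` the pencil, the derivative of the numerator `P = c₁ D J + c₂` has a part from `J` and a
part from `D`. Moving `D` across the pairing and replacing `c₁ D J` by `P - c₂`, the part from `J`
reproduces the terms of `J'` with opposite sign, up to a multiple of `c₂`. All remaining terms fall
under the four cyclic identities. -/
theorem isHamiltonianQuot_quotNum (ε a b c₁ c₂ : ℝ) :
    IsHamiltonianQuot (quotNum ε a b c₁ c₂) (opJ ε skewInv) where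
  opP := isFieldOp_quotNum ε a b c₁ c₂
  opQ := isFieldOp_opJ ε
  skew u X Y hu hX hY := by
    have hJX := hu.opJ ε hX
    have hJY := hu.opJ ε hY
    have hPX := hu.pencil ε a b hJX
    have hPY := hu.pencil ε a b hJY
    rw [quotNum_eq, quotNum_eq, pairing_add_right hJX (hPY.smul c₁) (hY.smul c₂),
      pairing_add_right hJY (hPX.smul c₁) (hX.smul c₂)]
    simp only [pairing_smul_right]
    rw [pairing_comm _ (pencil ε a b u (opJ ε skewInv u X)), pairing_pencil_skew ε a b hu hJX hJY,
      pairing_opJ_skew ε hu hX hY, pairing_comm X]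
    ring
  jacobi u X Y Z hu hX hY hZ := by
    -- The first term on the right cancels against the derivative of the denominator; the others are
    -- already sorted by the cyclic identity that removes them.
    have key : ∀ A B C, IsTest A → IsTest B → IsTest C →
        pairing (opJ ε skewInv u B)
          (opDer (quotNum ε a b c₁ c₂) u (quotNum ε a b c₁ c₂ u C) A) =
        ε * trip u (quotNum ε a b c₁ c₂ u C) A (quotNum ε a b c₁ c₂ u B)
        - c₂ * ε * (c₁ * (a * trip u (opJ (-ε) skewInv (jmul u) (opJ ε skewInv u C)) A B +
            b * trip u (jmul (opJ ε skewInv u C)) A B) + c₂ * trip u C A B)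
        + c₁ * a * ε * (c₁ * trip (jmul u) (jmul (pencil ε a b u (opJ ε skewInv u C)))
            (opJ ε skewInv u A) (opJ ε skewInv u B) +
            c₂ * trip (jmul u) (jmul C) (opJ ε skewInv u A) (opJ ε skewInv u B)) :=
      fun A B C hA hB hC => by
        have hJA := hu.opJ ε hA
        have hJB := hu.opJ ε hB
        have hJC := hu.opJ ε hC
        have hPB := hu.pencil ε a b hJB
        have hPC := hu.pencil ε a b hJC
        have hV := hu.quotNum ε a b c₁ c₂ hC
        have hW := hu.quotNum ε a b c₁ c₂ hB
        have hd := hu.opJd ε hV hA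
        have e1 : c₁ * pairing (pencil ε a b u (opJ ε skewInv u B))
            (opJd ε u (quotNum ε a b c₁ c₂ u C) A) =
            -ε * trip u (quotNum ε a b c₁ c₂ u C) A (quotNum ε a b c₁ c₂ u B) +
            c₂ * ε * trip u (quotNum ε a b c₁ c₂ u C) A B := by
          have h := pairing_add_left (hPB.smul c₁) (hB.smul c₂) hd
          rw [← quotNum_eq, pairing_comm, pairing_opJd ε hu hV hA hW, pairing_smul_left,
            pairing_smul_left, pairing_comm B, pairing_opJd ε hu hV hA hB] at h
          linear_combination -h
        have e2 : trip u (quotNum ε a b c₁ c₂ u C) A B =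
            c₁ * (a * trip u (opJ (-ε) skewInv (jmul u) (opJ ε skewInv u C)) A B +
            b * trip u (jmul (opJ ε skewInv u C)) A B) + c₂ * trip u C A B := by
          rw [quotNum_eq, trip_add hu (hPC.smul c₁) (hC.smul c₂) hA hB, trip_smul, trip_smul,
            pencil_eq, trip_add hu ((hu.jmul.opJ _ hJC).smul a) (hJC.jmul.smul b) hA hB,
            trip_smul, trip_smul]
        have e3 : trip (jmul u) (jmul (quotNum ε a b c₁ c₂ u C)) (opJ ε skewInv u A)
            (opJ ε skewInv u B) =
            c₁ * trip (jmul u) (jmul (pencil ε a b u (opJ ε skewInv u C)))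
              (opJ ε skewInv u A) (opJ ε skewInv u B) +
            c₂ * trip (jmul u) (jmul C) (opJ ε skewInv u A) (opJ ε skewInv u B) := by
          rw [quotNum_eq, jmul_add, jmul_smul, jmul_smul,
            trip_add hu.jmul (hPC.jmul.smul c₁) (hC.jmul.smul c₂) hJA hJB, trip_smul, trip_smul]
        have hd' := hu.jmul.opJd (-ε) hV.jmul hJA
        rw [opDer_quotNum ε a b c₁ c₂ hu hV hA,
          pairing_add_right hJB ((hu.pencil ε a b hd).smul c₁) (hd'.smul _), pairing_smul_right,
          pairing_smul_right, pairing_comm _ (opJd (-ε) _ _ _),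
          pairing_opJd (-ε) hu.jmul hV.jmul hJA hJB, e3,
          pairing_comm _ (pencil ε a b u _), pairing_pencil_skew ε a b hu hd hJB,
          pairing_comm (opJd ε _ _ _)]
        linear_combination -e1 - c₂ * ε * e2
    have hVX := hu.quotNum ε a b c₁ c₂ hX
    have hVY := hu.quotNum ε a b c₁ c₂ hY
    have hVZ := hu.quotNum ε a b c₁ c₂ hZ
    rw [key X Y Z hX hY hZ, key Y Z X hY hZ hX, key Z X Y hZ hX hY, opDer_opJ ε hu hVX hY,
      opDer_opJ ε hu hVY hZ, opDer_opJ ε hu hVZ hX, pairing_opJd ε hu hVX hY hVZ,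
      pairing_opJd ε hu hVY hZ hVX, pairing_opJd ε hu hVZ hX hVY]
    have t1 := trip_cyclic_opJ_opJ ε hu hX hY hZ
    have t2 := trip_cyclic_jmul_opJ ε hu hX hY hZ
    have t3 := trip_cyclic hu hX hY hZ
    have t4 := trip_cyclic_pencil ε a b hu (hu.opJ ε hX) (hu.opJ ε hY) (hu.opJ ε hZ)
    linear_combination -(c₂ * ε * c₁ * a) * t1 - (c₂ * ε * c₁ * b) * t2 - (c₂ * ε * c₂) * t3 +
      (c₁ * a * ε * c₁) * t4

theorem isCompatibleSymplectic_pencil (ε a b : ℝ) :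
    IsCompatibleSymplectic (pencil ε a b) (opJ ε skewInv) := fun c₁ c₂ =>
  isHamiltonianQuot_quotNum ε a b c₁ c₂

/-! ### Phase invariance and relations between the operators -/

theorem ip_hexp_mul (φ : ℝ) (a b : SplitC) : ip (hexp φ * a) (hexp φ * b) = ip a b := by
  have h := Real.cosh_sq_sub_sinh_sq φ
  simp only [ip, hexp, QuadraticAlgebra.re_mul, QuadraticAlgebra.im_mul]
  linear_combination (a.re * b.re - a.im * b.im) * h

theorem isPhaseInvariant_opJ (σ : ℝ) : IsPhaseInvariant (opJ σ skewInv) := by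
  intro φ u X _ hX
  funext x
  have hd : dx (fun x => hexp (-φ) * X x) x = hexp (-φ) * dx X x :=
    dx_eq_of_hasDerivAt
      ((((hX.hasDerivAt_re x).const_mul (hexp (-φ)).re).add
        ((hX.hasDerivAt_im x).const_mul (hexp (-φ)).im)).congr_deriv (by simp) |>.congr_of_eventuallyEq
          (.of_forall fun y => by simp))
      ((((hX.hasDerivAt_im x).const_mul (hexp (-φ)).re).add
        ((hX.hasDerivAt_re x).const_mul (hexp (-φ)).im)).congr_deriv (by simp) |>.congr_of_eventuallyEq
          (.of_forall fun y => by simp))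
  simp only [opJ_apply, hd, pin, ip_hexp_mul]
  rw [mul_sub, mul_smul_comm]

theorem jmul_mul (a : SplitC) (X : ℝ → SplitC) :
    jmul (fun x => a * X x) = fun x => a * jmul X x :=
  funext fun x => mul_left_comm jj a (X x)

theorem isPhaseInvariant_opH (ε : ℝ) : IsPhaseInvariant (opH ε skewInv) := by
  intro φ u X hu hX
  rw [opH_eq_opJ, opH_eq_opJ, jmul_mul]
  exact isPhaseInvariant_opJ (-ε) φ (jmul u) X hu.jmul hX

theorem isPhaseInvariant_opI : IsPhaseInvariant opI := fun φ _ X _ _ => jmul_mul (hexp (-φ)) X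

theorem isPhaseInvariant_opR (ε : ℝ) : IsPhaseInvariant (opR ε skewInv) := by
  intro φ u X hu hX
  rw [opR_eq_jmul, opR_eq_jmul, isPhaseInvariant_opJ ε φ u X hu hX, jmul_mul]

/-- This is `H I = I J`. Multiplying both arguments by `j` reverses the sign of `ip`, which
compensates the reversed sign of `ε`. All the operator relations follow from it and `j² = 1`. -/
theorem opJ_jmul_jmul (ε : ℝ) (u X : ℝ → SplitC) :
    opJ (-ε) skewInv (jmul u) (jmul X) = jmul (opJ ε skewInv u X) := by
  funext x
  simp only [opJ_apply, pin_jmul, jmul_jmul, dx_jmul]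
  simp only [jmul, opJ_apply, mul_sub, mul_smul_comm, neg_mul_neg]

theorem operator_relations (ε : ℝ) (u X : ℝ → SplitC) :
    opI u (opIinv u X) = X ∧ opIinv u (opI u X) = X ∧
      opH ε skewInv u (opIinv u X) = opI u (opJ ε skewInv u X) ∧
      opJ ε skewInv u (opI u X) = opIinv u (opH ε skewInv u X) ∧
      opR ε skewInv u X = opH ε skewInv u (opIinv u X) ∧
      opR ε skewInv u X = opI u (opJ ε skewInv u X) ∧
      opH ε skewInv u (opJ ε skewInv u X) = opR ε skewInv u (opR ε skewInv u X) := by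
  simp only [opI_eq_jmul, opIinv_eq_jmul, opR_eq_jmul, opH_eq_opJ, jmul_jmul, opJ_jmul_jmul,
    true_and]
  have h : ∀ Y, opJ ε skewInv u (jmul Y) = jmul (opJ (-ε) skewInv (jmul u) Y) := fun Y => by
    have h := opJ_jmul_jmul ε u (jmul Y)
    rw [jmul_jmul] at h
    rw [h, jmul_jmul]
  refine ⟨h X, ?_⟩
  rw [h, jmul_jmul]

/-! ### The hereditary recursion operator -/

theorem Fam.opR {U Y : ℝ → ℝ → SplitC} (ε : ℝ) (hU : Fam U) (hY : Fam Y) :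
    Fam fun s => opR ε skewInv (U s) (Y s) := (hU.opJ ε hY).jmul

theorem dS_opR {U Y : ℝ → ℝ → SplitC} (ε : ℝ) (hU : Fam U) (hY : Fam Y) (s : ℝ) :
    dS (fun s => opR ε skewInv (U s) (Y s)) s =
      opR ε skewInv (U s) (dS Y s) + jmul (opJd ε (U s) (dS U s) (Y s)) := by
  simp only [opR_eq_jmul]
  rw [dS_jmul, dS_opJ ε hU hY, jmul_add]

theorem opDer_opR (ε : ℝ) {u w X : ℝ → SplitC} (hu : IsTest u) (hw : IsTest w) (hX : IsTest X) :
    opDer (opR ε skewInv) u w X = jmul (opJd ε u w X) := by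
  rw [← opDer_opJ ε hu hw hX]
  exact dS_jmul (fun s => opJ ε skewInv (u + s • w) X) 0

theorem opR_add (ε : ℝ) {u X Y : ℝ → SplitC} (hu : IsTest u) (hX : IsTest X) (hY : IsTest Y) :
    opR ε skewInv u (X + Y) = opR ε skewInv u X + opR ε skewInv u Y := by
  rw [opR_eq_jmul, opJ_add ε hu hX hY, jmul_add]
  rfl

theorem opR_sub (ε : ℝ) {u X Y : ℝ → SplitC} (hu : IsTest u) (hX : IsTest X) (hY : IsTest Y) :
    opR ε skewInv u (X - Y) = opR ε skewInv u X - opR ε skewInv u Y := by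
  rw [opR_eq_jmul, opJ_sub ε hu hX hY, jmul_sub]
  rfl

theorem isFieldOp_opR (ε : ℝ) : IsFieldOp (opR ε skewInv) :=
  isFieldOp_of_fam (fun hU hY => hU.opR ε hY) fun u X Y hu hX hY a => by
    rw [opR_add ε hu (hX.smul a) hY, opR_eq_jmul, opJ_smul ε a u hX, jmul_smul]
    rfl

/-- After the nonlocal terms on the two sides are both expressed through `skewInv N`, what is left
is a pointwise identity for vectors in a plane. -/
theorem hereditary_identity (ε : ℝ) {u X Y : ℝ → SplitC} (hu : IsTest u) (hX : IsTest X)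
    (hY : IsTest Y) :
    jmul (opJd ε u (opR ε skewInv u X) Y) - jmul (opJd ε u (opR ε skewInv u Y) X) =
      opR ε skewInv u (jmul (opJd ε u X Y) - jmul (opJd ε u Y X)) := by
  have hRX := hu.opR ε hX
  have hRY := hu.opR ε hY
  set N : ℝ → ℝ := fun y => pin u Y y * ip (jmul u y) (X y) - pin u X y * ip (jmul u y) (Y y)
    with hN
  have iN : RTest N := (hu.pin_mul_ip hY hu.jmul hX).sub (hu.pin_mul_ip hX hu.jmul hY)
  set Z := jmul (opJd ε u X Y) - jmul (opJd ε u Y X) with hZ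
  have eZ : Z = fun x => -ε • (pin u Y x • jmul X x - pin u X x • jmul Y x) := by
    funext x
    -- The two terms in which `X` and `Y` are paired with each other cancel by symmetry, so only
    -- antiderivatives involving `u` survive in `Z`.
    simp only [hZ, Pi.sub_apply, jmul, opJd, pin_comm X Y]
    simp only [mul_neg, mul_add, mul_smul_comm]
    module
  -- The `D_x` parts combine into the derivative of `ip (j X) Y`, which `D_x⁻¹` undoes exactly; the
  -- nonlocal parts give `N`.
  have h1 : ∀ x, pin (opR ε skewInv u X) Y x - pin (opR ε skewInv u Y) X x =
      ip (jmul X x) (Y x) + ε * skewInv N x := fun x => by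
    rw [pin, pin, ← skewInv_sub (hRX.ip hY).integrable (hRY.ip hX).integrable,
      ← (hX.jmul.ip hY).skewInv_deriv x, ← skewInv_const_mul,
      ← skewInv_add (hX.jmul.ip hY).deriv.integrable (iN.const_mul ε).integrable]
    congr 1
    funext y
    rw [(hX.jmul.hasDerivAt_ip hY y).deriv, hN]
    simp [opR_eq_jmul, jmul, opJ_apply, dx_jmul, ip]
    ring
  have h2 : ∀ x, pin u Z x = ε * skewInv N x := fun x => by
    rw [pin, ← skewInv_const_mul]
    congr 1
    funext y
    rw [eZ, hN]
    simp [jmul, ip]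
    ring
  have h3 : ∀ x, dx Z x = -ε • (ip (u x) (Y x) • jmul X x + pin u Y x • jmul (dx X) x -
      (ip (u x) (X x) • jmul Y x + pin u X x • jmul (dx Y) x)) := fun x => by
    have pX := hu.hasDerivAt_pin hX x
    have pY := hu.hasDerivAt_pin hY x
    rw [eZ, ← dx_jmul, ← dx_jmul]
    exact dx_eq_of_hasDerivAt
      (((pY.mul (hX.jmul.hasDerivAt_re x)).sub (pX.mul (hY.jmul.hasDerivAt_re x))).const_mul (-ε))
      (((pY.mul (hX.jmul.hasDerivAt_im x)).sub (pX.mul (hY.jmul.hasDerivAt_im x))).const_mul (-ε))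
  funext x
  rw [opR_eq_jmul ε skewInv u Z]
  simp only [Pi.sub_apply]
  conv_rhs => rw [jmul, opJ_apply, h2, h3]
  have h1' := h1 x
  rw [sub_eq_iff_eq_add] at h1'
  simp only [jmul, opJd, h1']
  ext
  · simp [opR_eq_jmul, jmul, opJ_apply, ip]
    ring
  · simp [opR_eq_jmul, jmul, opJ_apply, ip]
    ring

theorem isHereditary_opR (ε : ℝ) : IsHereditary (opR ε skewInv) := by
  refine ⟨isFieldOp_opR ε, fun u X Y hu hX hY => ?_⟩
  rw [opDer_opR ε hu (hu.opR ε hX) hY, opDer_opR ε hu (hu.opR ε hY) hX, opDer_opR ε hu hX hY,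
    opDer_opR ε hu hY hX]
  exact hereditary_identity ε hu hX hY

/-- The flows generated by the recursion operator from the phase rotation. -/
def hierarchy (ε : ℝ) (n : ℕ) (u : ℝ → SplitC) : ℝ → SplitC := (opR ε skewInv u)^[n] (jmul u)

theorem hierarchy_succ (ε : ℝ) (n : ℕ) (u : ℝ → SplitC) :
    hierarchy ε (n + 1) u = opR ε skewInv u (hierarchy ε n u) :=
  Function.iterate_succ_apply' _ _ _

theorem Fam.hierarchy {U : ℝ → ℝ → SplitC} (ε : ℝ) (hU : Fam U) (n : ℕ) :
    Fam fun s => hierarchy ε n (U s) := by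
  induction n with
  | zero => exact hU.jmul
  | succ n ih => simpa only [hierarchy_succ] using hU.opR ε ih

/-- Induction on `n`. At the start `K = j u` is linear in `u` and generates the phase rotations,
under which `R` is equivariant. For the step, expand `(R K)' = R K' + R'[·] K`; the hereditary
identity for `X` and `K` then carries the relation from `K` to `R K`. -/
theorem hierarchy_recursion (ε : ℝ) (n : ℕ) {u X : ℝ → SplitC} (hu : IsTest u) (hX : IsTest X) :
    opDer (opR ε skewInv) u (hierarchy ε n u) X =
      vder (hierarchy ε n) u (opR ε skewInv u X) - opR ε skewInv u (vder (hierarchy ε n) u X) := by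
  induction n with
  | zero =>
    have h : ∀ w, vder (hierarchy ε 0) u w = jmul w := fun w => by
      rw [vder_eq_dS]
      refine (dS_jmul (fun s => u + s • w) 0).trans ?_
      rw [dS_line]
    rw [h, h, opDer_opR ε hu (hu.fam.hierarchy ε 0 |>.test 0) hX]
    funext x
    have e : pin (jmul u) X x = -pin u (jmul X) x := by rw [pin_jmul]
    simp only [Pi.sub_apply, opR_eq_jmul, hierarchy, Function.iterate_zero, id_eq]
    rw [jmul_jmul]
    simp only [jmul, opJd, opJ_apply, e]
    ext
    · simp [dx_jmul, jmul]
      ring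
    · simp [dx_jmul, jmul]
      ring
  | succ n ih =>
    have hK : IsTest (hierarchy ε n u) := (hu.fam.hierarchy ε n).test 0
    have hd : ∀ {w}, IsTest w → IsTest (vder (hierarchy ε n) u w) := fun hw =>
      ((hu.fam_line hw).hierarchy ε n).dS.test 0
    have hs : ∀ {w}, IsTest w → vder (hierarchy ε (n + 1)) u w =
        opR ε skewInv u (vder (hierarchy ε n) u w) + jmul (opJd ε u w (hierarchy ε n u)) :=
      fun {w} hw => by
        have hU := hu.fam_line hw
        have h := dS_opR ε hU (hU.hierarchy ε n) 0
        rw [dS_line] at h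
        simp only [zero_smul, add_zero] at h
        simp only [vder_eq_dS, hierarchy_succ]
        exact h
    have hR := hu.opR ε hX
    have her := hereditary_identity ε hu hX hK
    have hjX := (hu.opJd ε hX hK).jmul
    have hjK := (hu.opJd ε hK hX).jmul
    rw [opDer_opR ε hu hK hX] at ih
    rw [hs hR, hs hX, hierarchy_succ, opDer_opR ε hu (hu.opR ε hK) hX,
      opR_add ε hu (hu.opR ε (hd hX)) hjX]
    rw [opR_sub ε hu hjX hjK, ih, opR_sub ε hu (hd hR) (hu.opR ε (hd hX))] at her
    rw [sub_eq_iff_eq_add] at her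
    rw [her]
    abel

theorem isRecursion_hierarchy (ε : ℝ) (n : ℕ) :
    IsRecursion (opR ε skewInv) (hierarchy ε n) :=
  ⟨fun _ hu => (hu.fam.hierarchy ε n).test 0,
    fun _ _ hu hX => ⟨((hu.fam_line hX).hierarchy ε n).vDiff,
      ((hu.fam_line hX).hierarchy ε n).dS.test 0⟩,
    fun _ _ hu hX => hierarchy_recursion ε n hu hX⟩

/-! ### Iterated derivatives of families -/

theorem RFam.iteratedDeriv {f : ℝ → ℝ → ℝ} (hf : RFam f) (k : ℕ) :
    RFam fun s x => iteratedDeriv k (f s) x := by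
  induction k with
  | zero => simpa using hf
  | succ k ih => simpa only [iteratedDeriv_succ] using ih.deriv

theorem RFam.ds_iteratedDeriv {f : ℝ → ℝ → ℝ} (hf : RFam f) (k : ℕ) (s x : ℝ) :
    SpacelikeCurveFlow.ds (fun s x => _root_.iteratedDeriv k (f s) x) s x =
      _root_.iteratedDeriv k (SpacelikeCurveFlow.ds f s) x := by
  induction k generalizing x with
  | zero => simp
  | succ k ih =>
    simp only [iteratedDeriv_succ]
    rw [ds_deriv (f := fun s x => _root_.iteratedDeriv k (f s) x) (hf.iteratedDeriv k).smooth]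
    congr 1
    exact funext ih

theorem RFam.hasDerivAt_ds {f : ℝ → ℝ → ℝ} (hf : RFam f) (s x : ℝ) :
    HasDerivAt (fun r => f r x) (SpacelikeCurveFlow.ds f s x) s :=
  SpacelikeCurveFlow.hasDerivAt_ds hf.smooth s x

theorem RTest.iteratedDeriv {f : ℝ → ℝ} (hf : RTest f) (k : ℕ) : RTest (iteratedDeriv k f) :=
  (hf.rfam.iteratedDeriv k).rtest 0

theorem RTest.integral_deriv_mul {f g : ℝ → ℝ} (hf : RTest f) (hg : RTest g) :
    ∫ x, _root_.deriv f x * g x = -∫ x, f x * _root_.deriv g x := by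
  have h := integral_eq_zero_of_hasDerivAt (hf.mul hg)
    fun x => (hf.hasDerivAt x).mul (hg.hasDerivAt x)
  rw [integral_add (hf.deriv.mul hg).integrable (hf.mul hg.deriv).integrable] at h
  linarith

theorem RTest.integral_iteratedDeriv_mul {f g : ℝ → ℝ} (hf : RTest f) (hg : RTest g) (k : ℕ) :
    ∫ x, _root_.iteratedDeriv k f x * g x =
      (-1) ^ k * ∫ x, f x * _root_.iteratedDeriv k g x := by
  induction k generalizing g with
  | zero => simp
  | succ k ih =>
    rw [iteratedDeriv_succ, (hf.iteratedDeriv k).integral_deriv_mul hg, ih hg.deriv, pow_succ,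
      iteratedDeriv_succ']
    ring

theorem RFam.sum {ι : Type*} (t : Finset ι) {f : ι → ℝ → ℝ → ℝ} (hf : ∀ i, RFam (f i)) :
    RFam fun s x => ∑ i ∈ t, f i s x := by
  classical
  choose C hC h using fun i => (hf i).supp
  exact ⟨ContDiff.sum fun i _ => (hf i).smooth, ⋃ i ∈ t, C i,
    t.isCompact_biUnion fun i _ => hC i, fun s x hx => Finset.sum_eq_zero fun i hi =>
      h i s x fun hxi => hx (mem_biUnion hi hxi)⟩

/-! ### Variational derivatives along families -/

theorem Fam.exists_support {U : ℝ → ℝ → SplitC} (hU : Fam U) :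
    ∃ C : Set ℝ, IsCompact C ∧ ∀ s, ∀ x ∉ C, U s x = 0 := by
  obtain ⟨C, hC, h⟩ := hU.re.supp
  obtain ⟨D, hD, h'⟩ := hU.im.supp
  refine ⟨C ∪ D, hC.union hD, fun s x hx => ?_⟩
  rw [mem_union, not_or] at hx
  exact QuadraticAlgebra.ext (h s x hx.1) (h' s x hx.2)

theorem jet_eq_zero (n : ℕ) {u : ℝ → SplitC} {C : Set ℝ} (hC : IsClosed C)
    (h : ∀ x ∉ C, u x = 0) {x : ℝ} (hx : x ∉ C) : jet n u x = 0 := by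
  have hn : Cᶜ ∈ 𝓝 x := hC.isOpen_compl.mem_nhds hx
  have h1 : (fun y => (u y).re) =ᶠ[𝓝 x] fun _ => 0 := by
    filter_upwards [hn] with y hy
    rw [h y hy, QuadraticAlgebra.re_zero]
  have h2 : (fun y => (u y).im) =ᶠ[𝓝 x] fun _ => 0 := by
    filter_upwards [hn] with y hy
    rw [h y hy, QuadraticAlgebra.im_zero]
  funext k
  simp only [jet, h1.iteratedDeriv_eq, h2.iteratedDeriv_eq]
  simp

theorem Fam.contDiff_jet {U : ℝ → ℝ → SplitC} (hU : Fam U) (n : ℕ) :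
    ContDiff ℝ ∞ fun p : ℝ × ℝ => jet n (U p.1) p.2 :=
  contDiff_pi.2 fun k => (hU.re.iteratedDeriv k).smooth.prodMk (hU.im.iteratedDeriv k).smooth

theorem Fam.hasDerivAt_jet {U : ℝ → ℝ → SplitC} (hU : Fam U) (n : ℕ) (s x : ℝ) :
    HasDerivAt (fun r => jet n (U r) x) (jet n (SpacelikeCurveFlow.dS U s) x) s := by
  refine hasDerivAt_pi.2 fun k => ?_
  exact (((hU.re.iteratedDeriv k).hasDerivAt_ds s x).congr_deriv
    (hU.re.ds_iteratedDeriv k s x)).prodMk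
      (((hU.im.iteratedDeriv k).hasDerivAt_ds s x).congr_deriv (hU.im.ds_iteratedDeriv k s x))

theorem jet_eq_sum (n : ℕ) (u : ℝ → SplitC) (x : ℝ) :
    jet n u x = (∑ k : Fin (n + 1), iteratedDeriv k (fun y => (u y).re) x •
        (Pi.single k (1, 0) : Fin (n + 1) → ℝ × ℝ)) +
      ∑ k : Fin (n + 1), iteratedDeriv k (fun y => (u y).im) x •
        (Pi.single k (0, 1) : Fin (n + 1) → ℝ × ℝ) := by
  funext k
  simp [jet, Finset.sum_apply, Pi.single_apply, apply_ite]

/-- The partial derivative of a density in the direction `e` of the `k`-th jet variable,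
along a field. -/
def Density.partialDeriv (F : Density) (k : Fin (F.order + 1)) (e : ℝ × ℝ) (u : ℝ → SplitC)
    (x : ℝ) : ℝ :=
  fderiv ℝ (F.f x) (jet F.order u x) (Pi.single k e)

/-- The Hessian of a density along a field. -/
def Density.hess (F : Density) (u : ℝ → SplitC) (x : ℝ) (a b : Fin (F.order + 1) → ℝ × ℝ) : ℝ :=
  fderiv ℝ (fderiv ℝ (F.f x)) (jet F.order u x) a b

theorem Density.contDiff_slice (F : Density) (x : ℝ) : ContDiff ℝ ∞ (F.f x) :=
  F.smooth.comp (contDiff_const.prodMk contDiff_id :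
    ContDiff ℝ ∞ fun q : Fin (F.order + 1) → ℝ × ℝ => (x, q))

theorem Density.hess_comm (F : Density) (u : ℝ → SplitC) (x : ℝ)
    (a b : Fin (F.order + 1) → ℝ × ℝ) : F.hess u x a b = F.hess u x b a :=
  ((F.contDiff_slice x).contDiffAt.isSymmSndFDerivAt
    (by rw [minSmoothness_of_isRCLikeNormedField]
        exact WithTop.coe_le_coe.2 (le_top : (2 : ℕ∞) ≤ ⊤))).eq a b

/-- Where the field vanishes its jet is zero, and there the decay condition kills the first
derivative of the density outside `S`; hence the support lies in the union of `S` and the support of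
the family. -/
theorem Density.fam_partialDeriv (F : Density) (k : Fin (F.order + 1)) (e : ℝ × ℝ)
    {U : ℝ → ℝ → SplitC} (hU : Fam U) : RFam fun s => F.partialDeriv k e (U s) := by
  obtain ⟨C, hC, h⟩ := hU.exists_support
  obtain ⟨S, hS, h'⟩ := F.decay
  refine ⟨?_, S ∪ C, hS.union hC, fun s x hx => ?_⟩
  · have h1 : ContDiff ℝ ∞ (Function.uncurry fun (p : ℝ × ℝ) q => F.f p.2 q) :=
      F.smooth.comp ((contDiff_snd.comp contDiff_fst).prodMk contDiff_snd)
    exact (h1.fderiv (hU.contDiff_jet F.order) (by simp)).clm_apply contDiff_const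
  · rw [mem_union, not_or] at hx
    rw [Density.partialDeriv, jet_eq_zero _ hC.isClosed (h s) hx.2, (h' x hx.1).2]
    rfl

theorem Density.ds_partialDeriv (F : Density) (k : Fin (F.order + 1)) (e : ℝ × ℝ)
    {U : ℝ → ℝ → SplitC} (hU : Fam U) (s x : ℝ) :
    ds (fun s => F.partialDeriv k e (U s)) s x =
      F.hess (U s) x (jet F.order (dS U s) x) (Pi.single k e) := by
  have h1 : Differentiable ℝ (fderiv ℝ (F.f x)) :=
    ((F.contDiff_slice x).fderiv_right (m := ∞) (by simp)).differentiable (by simp)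
  set v : Fin (F.order + 1) → ℝ × ℝ := Pi.single k e
  have h2 : DifferentiableAt ℝ (fun q => fderiv ℝ (F.f x) q v) (jet F.order (U s) x) :=
    (h1 _).clm_apply (differentiableAt_const v)
  have h3 := (h2.hasFDerivAt.comp_hasDerivAt s (hU.hasDerivAt_jet F.order s x)).deriv
  rw [fderiv_clm_apply (h1 _) (differentiableAt_const v)] at h3
  refine h3.trans ?_
  simp [Density.hess]

theorem Density.fam_euler (F : Density) (e : ℝ × ℝ) {U : ℝ → ℝ → SplitC} (hU : Fam U) :
    RFam fun s => F.euler e (U s) :=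
  RFam.sum Finset.univ fun k => ((F.fam_partialDeriv k e hU).iteratedDeriv k).const_mul _

theorem Density.ds_euler (F : Density) (e : ℝ × ℝ) {U : ℝ → ℝ → SplitC} (hU : Fam U) (s x : ℝ) :
    ds (fun s => F.euler e (U s)) s x = ∑ k : Fin (F.order + 1), (-1) ^ (k : ℕ) *
      iteratedDeriv k (ds (fun s => F.partialDeriv k e (U s)) s) x := by
  have h : HasDerivAt (fun r => F.euler e (U r) x) _ s := HasDerivAt.fun_sum fun k _ =>
    (((F.fam_partialDeriv k e hU).iteratedDeriv k).hasDerivAt_ds s x).const_mul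
      ((-1 : ℝ) ^ (k : ℕ))
  rw [ds, h.deriv]
  exact Finset.sum_congr rfl fun k _ => by rw [(F.fam_partialDeriv k e hU).ds_iteratedDeriv]

/-- Integrating by parts `k` times produces a second factor `(-1) ^ k`, which cancels the one in the
Euler operator and leaves the Hessian of the density on two jets. -/
theorem Density.integral_ds_euler_mul (F : Density) (e : ℝ × ℝ) {U : ℝ → ℝ → SplitC}
    (hU : Fam U) (s : ℝ) {b : ℝ → ℝ} (hb : RTest b) :
    Integrable (fun x => F.hess (U s) x (jet F.order (dS U s) x)
      (∑ k : Fin (F.order + 1), iteratedDeriv k b x • Pi.single k e)) ∧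
    ∫ x, ds (fun s => F.euler e (U s)) s x * b x =
      ∫ x, F.hess (U s) x (jet F.order (dS U s) x)
        (∑ k : Fin (F.order + 1), iteratedDeriv k b x • Pi.single k e) := by
  have hG : ∀ k, RTest (ds (fun s => F.partialDeriv k e (U s)) s) := fun k =>
    (F.fam_partialDeriv k e hU).ds.rtest s
  have hi : ∀ k : Fin (F.order + 1), Integrable fun x =>
      ds (fun s => F.partialDeriv k e (U s)) s x * iteratedDeriv k b x := fun k =>
    ((hG k).mul (hb.iteratedDeriv k)).integrable
  have he : (fun x => F.hess (U s) x (jet F.order (dS U s) x)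
      (∑ k : Fin (F.order + 1), iteratedDeriv k b x • Pi.single k e)) = fun x =>
      ∑ k, ds (fun s => F.partialDeriv k e (U s)) s x * iteratedDeriv k b x := by
    funext x
    rw [Density.hess, map_sum]
    refine Finset.sum_congr rfl fun k _ => ?_
    rw [F.ds_partialDeriv k e hU, map_smul, smul_eq_mul, mul_comm, Density.hess]
  rw [he]
  refine ⟨integrable_finsetSum _ fun k _ => hi k, ?_⟩
  rw [integral_finsetSum _ fun k _ => hi k]
  simp only [F.ds_euler e hU, Finset.sum_mul]
  rw [integral_finsetSum _ fun k _ =>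
    ((((hG k).iteratedDeriv k).const_mul ((-1) ^ (k : ℕ))).mul hb).integrable]
  refine Finset.sum_congr rfl fun k _ => ?_
  simp only [mul_assoc]
  rw [integral_const_mul, (hG k).integral_iteratedDeriv_mul hb, ← mul_assoc, ← mul_pow]
  simp

theorem Density.fam_dUbar (F : Density) {U : ℝ → ℝ → SplitC} (hU : Fam U) :
    Fam fun s => F.dUbar (U s) :=
  ⟨(F.fam_euler (1, 0) hU).const_mul (1 / 2), (F.fam_euler (0, 1) hU).neg.const_mul (1 / 2)⟩

theorem Density.isTest_dUbar (F : Density) {u : ℝ → SplitC} (hu : IsTest u) :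
    IsTest (F.dUbar u) := (F.fam_dUbar hu.fam).test 0

/-- The minus sign in the `j`-part of `δF/δū` meets the minus sign of `ip`, so the indefinite
pairing yields the ordinary second variation, up to the factor `1 / 2` of the definition. -/
theorem Density.pairing_dS_dUbar (F : Density) {U : ℝ → ℝ → SplitC} (hU : Fam U) (s : ℝ)
    {v : ℝ → SplitC} (hv : IsTest v) :
    pairing (dS (fun s => F.dUbar (U s)) s) v =
      (1 / 2) * ∫ x, F.hess (U s) x (jet F.order (dS U s) x) (jet F.order v x) := by
  obtain ⟨i1, h1⟩ := F.integral_ds_euler_mul (1, 0) hU s hv.re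
  obtain ⟨i2, h2⟩ := F.integral_ds_euler_mul (0, 1) hU s hv.im
  have e1 : ∀ x, dS (fun s => F.dUbar (U s)) s x =
      ⟨(1 / 2) * ds (fun s => F.euler (1, 0) (U s)) s x,
        (1 / 2) * -ds (fun s => F.euler (0, 1) (U s)) s x⟩ := fun x =>
    dS_eq_of_hasDerivAt
      (((F.fam_euler (1, 0) hU).hasDerivAt_ds s x).const_mul (1 / 2))
      (((F.fam_euler (0, 1) hU).hasDerivAt_ds s x).neg.const_mul (1 / 2))
  have e2 : ∀ x, F.hess (U s) x (jet F.order (dS U s) x) (jet F.order v x) = _ := fun x => by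
    rw [jet_eq_sum F.order v, Density.hess, map_add]
  simp only [e2]
  simp only [Density.hess] at i1 i2 h1 h2
  rw [integral_add i1 i2, ← h1, ← h2,
    ← integral_add (((F.fam_euler (1, 0) hU).ds.rtest s).mul hv.re).integrable
      (((F.fam_euler (0, 1) hU).ds.rtest s).mul hv.im).integrable, ← integral_const_mul, pairing_eq]
  congr 1
  funext x
  rw [e1, ip]
  ring

theorem Density.isTest_vder_dUbar (F : Density) {u w : ℝ → SplitC} (hu : IsTest u)
    (hw : IsTest w) : IsTest (vder F.dUbar u w) := (F.fam_dUbar (hu.fam_line hw)).dS.test 0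

theorem Density.pairing_vder_comm (F : Density) {u v w : ℝ → SplitC} (hu : IsTest u)
    (hv : IsTest v) (hw : IsTest w) :
    pairing (vder F.dUbar u w) v = pairing (vder F.dUbar u v) w := by
  have h1 := F.pairing_dS_dUbar (hu.fam_line hw) 0 hv
  have h2 := F.pairing_dS_dUbar (hu.fam_line hv) 0 hw
  rw [dS_line] at h1 h2
  rw [vder_eq_dS, vder_eq_dS, h1, h2]
  simp only [zero_smul, add_zero, F.hess_comm u _ (jet F.order v _)]

/-! ### The pencil is Hamiltonian -/

theorem bracket_eq_pairing (D : FieldOp) (F G : Density) (u : ℝ → SplitC) :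
    bracket D F G u = pairing (F.dUbar u) (D u (G.dUbar u)) := by
  rw [bracket, bracketWith, pairing_eq]
  congr 1
  funext x
  simp [ip, Density.dU, Density.dUbar]

/-- The conjugate of twice the variational derivative of the bracket of two functionals with
respect to an operator of the pencil. -/
def bracketGrad (ε a b : ℝ) (F G : Density) (u : ℝ → SplitC) : ℝ → SplitC :=
  vder F.dUbar u (pencil ε a b u (G.dUbar u)) - vder G.dUbar u (pencil ε a b u (F.dUbar u)) +
    (a * ε) • ((fun x => pin (jmul u) (F.dUbar u) x • jmul (G.dUbar u) x) -
      fun x => pin (jmul u) (G.dUbar u) x • jmul (F.dUbar u) x)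

section

variable (ε a b : ℝ) (F G L : Density) {u w : ℝ → SplitC}

theorem isTest_bracketGrad (hu : IsTest u) : IsTest (bracketGrad ε a b F G u) := by
  have hF := F.isTest_dUbar hu
  have hG := G.isTest_dUbar hu
  exact ((F.isTest_vder_dUbar hu (hu.pencil ε a b hG)).sub
    (G.isTest_vder_dUbar hu (hu.pencil ε a b hF))).add
    (((hG.jmul.fun_smul (hu.jmul.contDiff_pin hF)).sub
      (hF.jmul.fun_smul (hu.jmul.contDiff_pin hG))).smul _)

theorem pairing_bracketGrad (hu : IsTest u) (hw : IsTest w) :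
    pairing (bracketGrad ε a b F G u) w =
      pairing (vder F.dUbar u (pencil ε a b u (G.dUbar u))) w -
        pairing (vder G.dUbar u (pencil ε a b u (F.dUbar u))) w +
      a * ε * trip (jmul u) (jmul w) (G.dUbar u) (F.dUbar u) := by
  have hF := F.isTest_dUbar hu
  have hG := G.isTest_dUbar hu
  have hF' := F.isTest_vder_dUbar hu (hu.pencil ε a b hG)
  have hG' := G.isTest_vder_dUbar hu (hu.pencil ε a b hF)
  have h1 := hG.jmul.fun_smul (hu.jmul.contDiff_pin hF)
  have h2 := hF.jmul.fun_smul (hu.jmul.contDiff_pin hG)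
  rw [bracketGrad, pairing_add_left (hF'.sub hG') ((h1.sub h2).smul _) hw, sub_eq_add_neg,
    ← neg_one_smul ℝ (vder G.dUbar u _), pairing_add_left hF' (hG'.smul _) hw,
    pairing_smul_left, pairing_smul_left, trip, pairing_eq ((_ : ℝ → SplitC) - _)]
  have e : ∀ x, ip (((fun x => pin (jmul u) (F.dUbar u) x • jmul (G.dUbar u) x) -
      fun x => pin (jmul u) (G.dUbar u) x • jmul (F.dUbar u) x) x) (w x) =
      ip (jmul w x) (F.dUbar u x) * pin (jmul u) (G.dUbar u) x -
        ip (jmul w x) (G.dUbar u x) * pin (jmul u) (F.dUbar u) x := fun x => by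
    simp [ip, jmul]
    ring
  simp only [e]
  ring

/-- Product rule for `⟨δF/δū, D δG/δū⟩`: symmetry of the second variation, with skewness of `D` for
the second factor, brings `w` into the free slot, and the derivative of `D` itself contributes a
`trip` term. -/
theorem hasDerivAt_bracket_pencil (hu : IsTest u) (hw : IsTest w) :
    HasDerivAt (fun s : ℝ => bracket (pencil ε a b) F G (u + s • w))
      (pairing (bracketGrad ε a b F G u) w) 0 := by
  have hU := hu.fam_line hw
  have hF := F.isTest_dUbar hu
  have hG := G.isTest_dUbar hu
  have hDF := hu.pencil ε a b hF
  have hDG := hu.pencil ε a b hG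
  have h := (F.fam_dUbar hU).hasDerivAt_pairing (hU.pencil ε a b (G.fam_dUbar hU)) 0
  rw [dS_pencil ε a b hU (G.fam_dUbar hU), dS_line, ← vder_eq_dS F.dUbar,
    ← vder_eq_dS G.dUbar] at h
  simp only [zero_smul, add_zero, ← bracket_eq_pairing] at h
  have hd := G.isTest_vder_dUbar hu hw
  have hj := hu.jmul.opJd (-ε) hw.jmul hG
  rw [pairing_add_right hF (hu.pencil ε a b hd) (hj.smul a), pairing_smul_right,
    pairing_comm _ (opJd _ _ _ _), pairing_opJd _ hu.jmul hw.jmul hG hF,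
    F.pairing_vder_comm hu hDG hw, pairing_comm _ (pencil ε a b u _),
    pairing_pencil_skew ε a b hu hd hF, G.pairing_vder_comm hu hDF hw] at h
  rw [pairing_bracketGrad ε a b F G hu hw]
  exact h.congr_deriv (by ring)

theorem re_half_star_mul (m z : SplitC) : ((1 / 2 : ℝ) • star m * z).re = (1 / 2) * ip m z := by
  simp [ip]
  ring

theorem isVarDeriv_bracket_pencil :
    IsVarDeriv (bracket (pencil ε a b) F G)
      fun u x => (1 / 2 : ℝ) • star (bracketGrad ε a b F G u x) := by
  intro u hu
  have hm := isTest_bracketGrad ε a b F G hu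
  refine ⟨?_, ?_, fun w hw => ?_⟩
  · simpa using (hm.re.const_mul 2⁻¹).continuous
  · simpa using (hm.im.const_mul 2⁻¹).neg.continuous
  · refine (hasDerivAt_bracket_pencil ε a b F G hu hw).congr_deriv ?_
    rw [pairing_eq]
    congr 1
    funext x
    rw [re_half_star_mul]
    ring

theorem bracketWith_bracketGrad (hu : IsTest u) :
    bracketWith (pencil ε a b) (fun u x => (1 / 2 : ℝ) • star (bracketGrad ε a b F G u x)) L u =
      (1 / 2) * (pairing (vder F.dUbar u (pencil ε a b u (G.dUbar u)))
          (pencil ε a b u (L.dUbar u)) -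
        pairing (vder G.dUbar u (pencil ε a b u (F.dUbar u))) (pencil ε a b u (L.dUbar u)) +
        a * ε * trip (jmul u) (jmul (pencil ε a b u (L.dUbar u))) (G.dUbar u) (F.dUbar u)) := by
  rw [← pairing_bracketGrad ε a b F G hu (hu.pencil ε a b (L.isTest_dUbar hu)), bracketWith,
    pairing_eq, ← integral_const_mul]
  congr 1
  funext x
  exact re_half_star_mul _ _

end

theorem isHamiltonian_pencil (ε a b : ℝ) : IsHamiltonian (pencil ε a b) where
  op := isFieldOp_pencil ε a b
  skew F G u hu := by
    rw [bracket_eq_pairing, bracket_eq_pairing, pairing_comm, pairing_pencil_skew ε a b hu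
      (G.isTest_dUbar hu) (F.isTest_dUbar hu)]
    ring
  jacobi F G L := by
    refine ⟨_, _, _, isVarDeriv_bracket_pencil ε a b F G, isVarDeriv_bracket_pencil ε a b G L,
      isVarDeriv_bracket_pencil ε a b L F, fun u hu => ?_⟩
    have hF := F.isTest_dUbar hu
    have hG := G.isTest_dUbar hu
    have hL := L.isTest_dUbar hu
    have hDF := hu.pencil ε a b hF
    have hDG := hu.pencil ε a b hG
    have hDL := hu.pencil ε a b hL
    rw [bracketWith_bracketGrad ε a b F G L hu, bracketWith_bracketGrad ε a b G L F hu,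
      bracketWith_bracketGrad ε a b L F G hu, F.pairing_vder_comm hu hDL hDG,
      G.pairing_vder_comm hu hDL hDF, L.pairing_vder_comm hu hDF hDG]
    -- After the symmetry rewrites the six second-variation terms cancel in pairs; only the cyclic
    -- sum coming from the derivative of the operator is left.
    linear_combination (1 / 2) * a * ε * trip_cyclic_pencil ε a b hu hG hF hL

theorem areCompatible_opH_opI (ε : ℝ) : AreCompatible (opH ε skewInv) opI :=
  isHamiltonian_pencil ε

/-! ### Calculus on the parameter domain of a flow -/

theorem eta_comm (v w : Mink) : eta v w = eta w v := by
  simp only [eta]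
  ring

theorem eta_add_left (v w z : Mink) : eta (v + w) z = eta v z + eta w z := by
  simp only [eta, Pi.add_apply]
  ring

theorem eta_smul_left (c : ℝ) (v z : Mink) : eta (c • v) z = c * eta v z := by
  simp only [eta, Pi.smul_apply, smul_eq_mul]
  ring

theorem eta_add_right (v w z : Mink) : eta z (v + w) = eta z v + eta z w := by
  rw [eta_comm, eta_add_left, eta_comm v, eta_comm w]

theorem eta_smul_right (c : ℝ) (v z : Mink) : eta z (c • v) = c * eta z v := by
  rw [eta_comm, eta_smul_left, eta_comm]

theorem hasDerivAt_eta {f g : ℝ → Mink} {f' g' : Mink} {x : ℝ} (hf : HasDerivAt f f' x)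
    (hg : HasDerivAt g g' x) :
    HasDerivAt (fun y => eta (f y) (g y)) (eta f' (g x) + eta (f x) g') x := by
  have h1 := hasDerivAt_pi.1 hf
  have h2 := hasDerivAt_pi.1 hg
  refine ((((h1 0).mul (h2 0)).neg.add ((h1 1).mul (h2 1))).add ((h1 2).mul (h2 2))).congr_deriv ?_
  simp only [eta]
  ring

/-- Joint smoothness of `f (t, x)` on `A × K`. -/
def SmoothOn (A K : Set ℝ) (f : ℝ → ℝ → Mink) : Prop :=
  ContDiffOn ℝ ∞ (fun p : ℝ × ℝ => f p.1 p.2) (A ×ˢ K)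

section

variable {A K : Set ℝ} {f g : ℝ → ℝ → Mink} {t x : ℝ}

theorem SmoothOn.hasFDerivAt (hA : IsOpen A) (hK : IsOpen K) (hf : SmoothOn A K f) (ht : t ∈ A)
    (hx : x ∈ K) : HasFDerivAt (fun p : ℝ × ℝ => f p.1 p.2)
      (fderiv ℝ (fun p : ℝ × ℝ => f p.1 p.2) (t, x)) (t, x) :=
  ((hf.contDiffAt ((hA.prod hK).mem_nhds ⟨ht, hx⟩)).differentiableAt (by simp)).hasFDerivAt

theorem SmoothOn.hasDerivAt_px_aux (hA : IsOpen A) (hK : IsOpen K) (hf : SmoothOn A K f)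
    (ht : t ∈ A) (hx : x ∈ K) :
    HasDerivAt (fun y => f t y) (fderiv ℝ (fun p : ℝ × ℝ => f p.1 p.2) (t, x) (0, 1)) x :=
  (hf.hasFDerivAt hA hK ht hx).comp_hasDerivAt x
    ((hasDerivAt_const x t).prodMk (hasDerivAt_id x))

theorem SmoothOn.hasDerivAt_pt_aux (hA : IsOpen A) (hK : IsOpen K) (hf : SmoothOn A K f)
    (ht : t ∈ A) (hx : x ∈ K) :
    HasDerivAt (fun s => f s x) (fderiv ℝ (fun p : ℝ × ℝ => f p.1 p.2) (t, x) (1, 0)) t :=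
  HasFDerivAt.comp_hasDerivAt (l := fun p : ℝ × ℝ => f p.1 p.2) (f := fun s : ℝ => (s, x)) t
    (hf.hasFDerivAt hA hK ht hx) ((hasDerivAt_id t).prodMk (hasDerivAt_const t x))

theorem SmoothOn.hasDerivAt_px (hA : IsOpen A) (hK : IsOpen K) (hf : SmoothOn A K f)
    (ht : t ∈ A) (hx : x ∈ K) : HasDerivAt (fun y => f t y) (px f t x) x :=
  (hf.hasDerivAt_px_aux hA hK ht hx).differentiableAt.hasDerivAt

theorem SmoothOn.hasDerivAt_pt (hA : IsOpen A) (hK : IsOpen K) (hf : SmoothOn A K f)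
    (ht : t ∈ A) (hx : x ∈ K) : HasDerivAt (fun s => f s x) (pt f t x) t :=
  (hf.hasDerivAt_pt_aux hA hK ht hx).differentiableAt.hasDerivAt

theorem SmoothOn.px_eq (hA : IsOpen A) (hK : IsOpen K) (hf : SmoothOn A K f) {p : ℝ × ℝ}
    (hp : p ∈ A ×ˢ K) : px f p.1 p.2 = fderiv ℝ (fun p : ℝ × ℝ => f p.1 p.2) p (0, 1) :=
  (hf.hasDerivAt_px_aux hA hK hp.1 hp.2).deriv

theorem SmoothOn.pt_eq (hA : IsOpen A) (hK : IsOpen K) (hf : SmoothOn A K f) {p : ℝ × ℝ}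
    (hp : p ∈ A ×ˢ K) : pt f p.1 p.2 = fderiv ℝ (fun p : ℝ × ℝ => f p.1 p.2) p (1, 0) :=
  (hf.hasDerivAt_pt_aux hA hK hp.1 hp.2).deriv

theorem SmoothOn.px (hA : IsOpen A) (hK : IsOpen K) (hf : SmoothOn A K f) :
    SmoothOn A K (px f) :=
  ((hf.fderiv_of_isOpen (hA.prod hK) (by simp)).clm_apply contDiffOn_const).congr
    fun _ hp => hf.px_eq hA hK hp

theorem SmoothOn.pt (hA : IsOpen A) (hK : IsOpen K) (hf : SmoothOn A K f) :
    SmoothOn A K (pt f) :=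
  ((hf.fderiv_of_isOpen (hA.prod hK) (by simp)).clm_apply contDiffOn_const).congr
    fun _ hp => hf.pt_eq hA hK hp

theorem SmoothOn.pt_px (hA : IsOpen A) (hK : IsOpen K) (hf : SmoothOn A K f) (ht : t ∈ A)
    (hx : x ∈ K) :
    SpacelikeCurveFlow.pt (SpacelikeCurveFlow.px f) t x =
      SpacelikeCurveFlow.px (SpacelikeCurveFlow.pt f) t x := by
  have hO : A ×ˢ K ∈ 𝓝 (t, x) := (hA.prod hK).mem_nhds ⟨ht, hx⟩
  have hd : DifferentiableAt ℝ (fderiv ℝ fun p : ℝ × ℝ => f p.1 p.2) (t, x) :=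
    ((hf.fderiv_of_isOpen (m := ∞) (hA.prod hK) (by simp)).contDiffAt hO).differentiableAt (by simp)
  have h1 : (fun p : ℝ × ℝ => SpacelikeCurveFlow.px f p.1 p.2) =ᶠ[𝓝 (t, x)]
      fun p => fderiv ℝ (fun p : ℝ × ℝ => f p.1 p.2) p (0, 1) := by
    filter_upwards [hO] with p hp using hf.px_eq hA hK hp
  have h2 : (fun p : ℝ × ℝ => SpacelikeCurveFlow.pt f p.1 p.2) =ᶠ[𝓝 (t, x)]
      fun p => fderiv ℝ (fun p : ℝ × ℝ => f p.1 p.2) p (1, 0) := by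
    filter_upwards [hO] with p hp using hf.pt_eq hA hK hp
  have e1 := (hf.px hA hK).pt_eq hA hK (p := (t, x)) ⟨ht, hx⟩
  have e2 := (hf.pt hA hK).px_eq hA hK (p := (t, x)) ⟨ht, hx⟩
  rw [h1.fderiv_eq, fderiv_clm_apply hd (differentiableAt_const _)] at e1
  rw [h2.fderiv_eq, fderiv_clm_apply hd (differentiableAt_const _)] at e2
  refine e1.trans (Eq.trans ?_ e2.symm)
  simpa using ((hf.contDiffAt hO).isSymmSndFDerivAt
    (by rw [minSmoothness_of_isRCLikeNormedField]
        exact WithTop.coe_le_coe.2 (le_top : (2 : ℕ∞) ≤ ⊤))).eq (1, 0) (0, 1)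

theorem eta_pt_of_const (hA : IsOpen A) (hK : IsOpen K) (hf : SmoothOn A K f)
    (hg : SmoothOn A K g) {c : ℝ} (h : ∀ t ∈ A, ∀ x ∈ K, eta (f t x) (g t x) = c) (ht : t ∈ A)
    (hx : x ∈ K) : eta (pt f t x) (g t x) + eta (f t x) (pt g t x) = 0 := by
  refine (hasDerivAt_eta (hf.hasDerivAt_pt hA hK ht hx) (hg.hasDerivAt_pt hA hK ht hx)).unique
    ((hasDerivAt_const t c).congr_of_eventuallyEq ?_)
  filter_upwards [hA.mem_nhds ht] with s hs using h s hs x hx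

theorem eta_px_of_const (hA : IsOpen A) (hK : IsOpen K) (hf : SmoothOn A K f)
    (hg : SmoothOn A K g) {c : ℝ} (h : ∀ t ∈ A, ∀ x ∈ K, eta (f t x) (g t x) = c) (ht : t ∈ A)
    (hx : x ∈ K) : eta (px f t x) (g t x) + eta (f t x) (px g t x) = 0 := by
  refine (hasDerivAt_eta (hf.hasDerivAt_px hA hK ht hx) (hg.hasDerivAt_px hA hK ht hx)).unique
    ((hasDerivAt_const x c).congr_of_eventuallyEq ?_)
  filter_upwards [hK.mem_nhds hx] with s hs using h t ht s hs

end

/-! ### Antiderivatives from a base point, and locality on the interval of the curve. -/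

theorem antideriv_eq {K : Set ℝ} (hK : K.OrdConnected) {G f : ℝ → ℝ} {x₀ x : ℝ} (hx₀ : x₀ ∈ K)
    (hx : x ∈ K) (hG : ∀ y ∈ K, HasDerivAt G (f y) y) (hf : ContinuousOn f K) :
    antideriv x₀ (G x₀) f x = G x := by
  have hs : uIcc x₀ x ⊆ K := hK.uIcc_subset hx₀ hx
  rw [antideriv, intervalIntegral.integral_eq_sub_of_hasDerivAt (fun y hy => hG y (hs hy))
    (hf.mono hs).intervalIntegrable]
  ring

theorem antideriv_congr {K : Set ℝ} (hK : K.OrdConnected) {f g : ℝ → ℝ} {x₀ x : ℝ} (c : ℝ)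
    (hx₀ : x₀ ∈ K) (hx : x ∈ K) (h : ∀ y ∈ K, f y = g y) :
    antideriv x₀ c f x = antideriv x₀ c g x := by
  rw [antideriv, antideriv, intervalIntegral.integral_congr fun y hy =>
    h y (hK.uIcc_subset hx₀ hx hy)]

theorem dx_congr_of_eqOn {K : Set ℝ} (hK : IsOpen K) {f g : ℝ → SplitC} {x : ℝ} (hx : x ∈ K)
    (h : ∀ y ∈ K, f y = g y) : dx f x = dx g x := by
  have h1 : f =ᶠ[𝓝 x] g := by
    filter_upwards [hK.mem_nhds hx] with y hy using h y hy
  ext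
  · exact (h1.fun_comp QuadraticAlgebra.re).deriv_eq
  · exact (h1.fun_comp QuadraticAlgebra.im).deriv_eq

/-! ### The moving frame equations -/

/-- The orientation condition makes the determinant of the frame equal to `η(e₂, e₂) = ε ≠ 0`, so a
vector orthogonal to all three frame vectors is zero. This is applied to the remainder of the
expansion. -/
theorem mink_expand {ε : ℝ} (hε : ε * ε = 1) {T e₁ e₂ : Mink} (hT : eta T T = 1)
    (h1 : eta e₁ e₁ = -ε) (h2 : eta e₂ e₂ = ε) (hT1 : eta T e₁ = 0) (hT2 : eta T e₂ = 0)
    (h12 : eta e₁ e₂ = 0) (ho : mcross T e₁ = e₂) (v : Mink) :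
    v = eta v T • T + (-ε * eta v e₁) • e₁ + (ε * eta v e₂) • e₂ := by
  have hdet : (Matrix.of ![T, e₁, e₂]).det ≠ 0 := by
    rw [← eta_mcross, ho, h2]
    rintro rfl
    simp at hε
  set w : Mink := v + (-1 : ℝ) • (eta v T • T + (-ε * eta v e₁) • e₁ + (ε * eta v e₂) • e₂)
    with hw
  have w0 : eta T w = 0 := by
    simp only [hw, eta_add_right, eta_smul_right, hT, hT1, hT2, eta_comm v]
    ring
  have w1 : eta e₁ w = 0 := by
    simp only [hw, eta_add_right, eta_smul_right, h1, eta_comm e₁ T, hT1, h12, eta_comm v]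
    linear_combination -(eta e₁ v) * hε
  have w2 : eta e₂ w = 0 := by
    simp only [hw, eta_add_right, eta_smul_right, h2, eta_comm e₂ T, eta_comm e₂ e₁, hT2, h12,
      eta_comm v]
    linear_combination -(eta e₂ v) * hε
  -- Lowering the index of the remainder with the metric turns the three orthogonality relations
  -- into a linear system with the frame as matrix.
  have hz : (![-w 0, w 1, w 2] : Fin 3 → ℝ) = 0 := by
    refine Matrix.eq_zero_of_mulVec_eq_zero hdet ?_
    simp only [eta] at w0 w1 w2
    funext i
    fin_cases i <;> simp [Matrix.mulVec, dotProduct, Fin.sum_univ_three]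
    · linarith
    · linarith
    · linarith
  have hw0 : w = 0 := by
    have z0 := congrFun hz 0
    have z1 := congrFun hz 1
    have z2 := congrFun hz 2
    simp at z0 z1 z2
    funext i
    fin_cases i <;> simp [z0, z1, z2]
  rw [hw0] at hw
  have h := hw.symm
  rw [neg_one_smul, ← sub_eq_add_neg, sub_eq_zero] at h
  exact h

section

variable {ε : ℝ} {A K : Set ℝ} {γ e₁ e₂ : ℝ → ℝ → Mink}

theorem curve_expand (hε : ε * ε = 1) (hγ : IsInelasticFlow ε A K γ)
    (he : IsParallelFrame ε A K γ e₁ e₂) {t x : ℝ} (ht : t ∈ A) (hx : x ∈ K) (v : Mink) :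
    v = eta v (px γ t x) • px γ t x + (-ε * eta v (e₁ t x)) • e₁ t x +
      (ε * eta v (e₂ t x)) • e₂ t x :=
  mink_expand hε (hγ.unit t ht x hx) (he.norm₁ t ht x hx) (he.norm₂ t ht x hx)
    (he.orth₁ t ht x hx) (he.orth₂ t ht x hx) (he.orth₁₂ t ht x hx) (he.orient t ht x hx) v

theorem px_e₁_eq (hγ : IsInelasticFlow ε A K γ) (he : IsParallelFrame ε A K γ e₁ e₂) {t x : ℝ}
    (ht : t ∈ A) (hx : x ∈ K) : px e₁ t x = (covU γ e₁ e₂ t x).re • px γ t x := by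
  obtain ⟨c, hc⟩ := he.parallel₁ t ht x hx
  rw [covU, hc, eta_smul_left, hγ.unit t ht x hx, mul_one]

theorem px_e₂_eq (hγ : IsInelasticFlow ε A K γ) (he : IsParallelFrame ε A K γ e₁ e₂) {t x : ℝ}
    (ht : t ∈ A) (hx : x ∈ K) : px e₂ t x = (covU γ e₁ e₂ t x).im • px γ t x := by
  obtain ⟨c, hc⟩ := he.parallel₂ t ht x hx
  rw [covU, hc, eta_smul_left, hγ.unit t ht x hx, mul_one]

theorem pt_e₁_eq (hε : ε * ε = 1) (hγ : IsInelasticFlow ε A K γ)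
    (he : IsParallelFrame ε A K γ e₁ e₂) {t x : ℝ} (ht : t ∈ A) (hx : x ∈ K) :
    pt e₁ t x = (covOmega γ e₁ e₂ t x).re • px γ t x + omega0 ε e₁ e₂ t x • e₂ t x := by
  have h1 := eta_pt_of_const hγ.openA hγ.openK he.smooth₁ he.smooth₁ he.norm₁ ht hx
  rw [eta_comm (e₁ t x), ← two_mul] at h1
  have h := curve_expand hε hγ he ht hx (pt e₁ t x)
  rw [show eta (pt e₁ t x) (e₁ t x) = 0 by linarith, mul_zero, zero_smul, add_zero] at h
  exact h

theorem pt_e₂_eq (hε : ε * ε = 1) (hγ : IsInelasticFlow ε A K γ)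
    (he : IsParallelFrame ε A K γ e₁ e₂) {t x : ℝ} (ht : t ∈ A) (hx : x ∈ K) :
    pt e₂ t x = (covOmega γ e₁ e₂ t x).im • px γ t x + omega0 ε e₁ e₂ t x • e₁ t x := by
  have h1 := eta_pt_of_const hγ.openA hγ.openK he.smooth₂ he.smooth₂ he.norm₂ ht hx
  have h2 := eta_pt_of_const hγ.openA hγ.openK he.smooth₁ he.smooth₂ he.orth₁₂ ht hx
  rw [eta_comm (e₂ t x), ← two_mul] at h1
  have h := curve_expand hε hγ he ht hx (pt e₂ t x)
  rw [show eta (pt e₂ t x) (e₂ t x) = 0 by linarith, mul_zero, zero_smul, add_zero] at h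
  refine h.trans ?_
  rw [omega0, show eta (pt e₁ t x) (e₂ t x) = -eta (pt e₂ t x) (e₁ t x) by
    rw [eta_comm (pt e₂ t x)]; linarith]
  simp only [covOmega, mul_neg, neg_mul]

theorem pxx_eq (hε : ε * ε = 1) (hγ : IsInelasticFlow ε A K γ)
    (he : IsParallelFrame ε A K γ e₁ e₂) {t x : ℝ} (ht : t ∈ A) (hx : x ∈ K) :
    px (px γ) t x = (ε * (covU γ e₁ e₂ t x).re) • e₁ t x +
      (-ε * (covU γ e₁ e₂ t x).im) • e₂ t x := by
  have hT : SmoothOn A K (px γ) := SmoothOn.px hγ.openA hγ.openK hγ.smooth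
  have h0 := eta_px_of_const hγ.openA hγ.openK hT hT hγ.unit ht hx
  have h1 := eta_px_of_const hγ.openA hγ.openK hT he.smooth₁ he.orth₁ ht hx
  have h2 := eta_px_of_const hγ.openA hγ.openK hT he.smooth₂ he.orth₂ ht hx
  rw [eta_comm (px γ t x), ← two_mul] at h0
  rw [eta_comm (px γ t x) (px e₁ t x)] at h1
  rw [eta_comm (px γ t x) (px e₂ t x)] at h2
  have h := curve_expand hε hγ he ht hx (px (px γ) t x)
  rw [show eta (px (px γ) t x) (px γ t x) = 0 by linarith,
    show eta (px (px γ) t x) (e₁ t x) = -eta (px e₁ t x) (px γ t x) by linarith,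
    show eta (px (px γ) t x) (e₂ t x) = -eta (px e₂ t x) (px γ t x) by linarith, zero_smul,
    zero_add, neg_mul_neg, mul_neg, ← neg_mul] at h
  exact h

/-- Differentiate `η(e_{1t}, T)` in `x`. Since `e_{1tx} = e_{1xt}` and `η(T_t, T) = 0`, the first
term is the `t`-derivative of `u₁`; in the second only the `e₂`-components of `e_{1t}` and `T_x`
meet. -/
theorem hasDerivAt_omega_re (hε : ε * ε = 1) (hγ : IsInelasticFlow ε A K γ)
    (he : IsParallelFrame ε A K γ e₁ e₂) {t x : ℝ} (ht : t ∈ A) (hx : x ∈ K) :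
    HasDerivAt (fun y => (covOmega γ e₁ e₂ t y).re)
      ((covUt γ e₁ e₂ t x).re - omega0 ε e₁ e₂ t x * (covU γ e₁ e₂ t x).im) x := by
  have hA := hγ.openA
  have hK := hγ.openK
  have hT : SmoothOn A K (px γ) := SmoothOn.px hA hK hγ.smooth
  have hs : SmoothOn A K e₁ := he.smooth₁
  have h0 := eta_pt_of_const hA hK hT hT hγ.unit ht hx
  rw [eta_comm (pt (px γ) t x), ← two_mul] at h0
  have hut : (covUt γ e₁ e₂ t x).re = eta (pt (px e₁) t x) (px γ t x) := by
    refine (hasDerivAt_eta ((hs.px hA hK).hasDerivAt_pt hA hK ht hx)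
      (hT.hasDerivAt_pt hA hK ht hx)).deriv.trans ?_
    rw [px_e₁_eq hγ he ht hx, eta_smul_left]
    linear_combination (covU γ e₁ e₂ t x).re / 2 * h0
  refine (hasDerivAt_eta ((hs.pt hA hK).hasDerivAt_px hA hK ht hx)
    (hT.hasDerivAt_px hA hK ht hx)).congr_deriv ?_
  rw [hut, hs.pt_px hA hK ht hx, pxx_eq hε hγ he ht hx, pt_e₁_eq hε hγ he ht hx]
  simp only [eta_add_left, eta_add_right, eta_smul_left, eta_smul_right, he.orth₁ t ht x hx,
    he.orth₂ t ht x hx, he.norm₂ t ht x hx, eta_comm (e₂ t x) (e₁ t x), he.orth₁₂ t ht x hx]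
  linear_combination -(omega0 ε e₁ e₂ t x * (covU γ e₁ e₂ t x).im) * hε

theorem hasDerivAt_omega_im (hε : ε * ε = 1) (hγ : IsInelasticFlow ε A K γ)
    (he : IsParallelFrame ε A K γ e₁ e₂) {t x : ℝ} (ht : t ∈ A) (hx : x ∈ K) :
    HasDerivAt (fun y => (covOmega γ e₁ e₂ t y).im)
      ((covUt γ e₁ e₂ t x).im - omega0 ε e₁ e₂ t x * (covU γ e₁ e₂ t x).re) x := by
  have hA := hγ.openA
  have hK := hγ.openK
  have hT : SmoothOn A K (px γ) := SmoothOn.px hA hK hγ.smooth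
  have hs : SmoothOn A K e₂ := he.smooth₂
  have h0 := eta_pt_of_const hA hK hT hT hγ.unit ht hx
  rw [eta_comm (pt (px γ) t x), ← two_mul] at h0
  have hut : (covUt γ e₁ e₂ t x).im = eta (pt (px e₂) t x) (px γ t x) := by
    refine (hasDerivAt_eta ((hs.px hA hK).hasDerivAt_pt hA hK ht hx)
      (hT.hasDerivAt_pt hA hK ht hx)).deriv.trans ?_
    rw [px_e₂_eq hγ he ht hx, eta_smul_left]
    linear_combination (covU γ e₁ e₂ t x).im / 2 * h0
  refine (hasDerivAt_eta ((hs.pt hA hK).hasDerivAt_px hA hK ht hx)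
    (hT.hasDerivAt_px hA hK ht hx)).congr_deriv ?_
  rw [hut, hs.pt_px hA hK ht hx, pxx_eq hε hγ he ht hx, pt_e₂_eq hε hγ he ht hx]
  simp only [eta_add_left, eta_add_right, eta_smul_left, eta_smul_right, he.orth₁ t ht x hx,
    he.orth₂ t ht x hx, he.norm₁ t ht x hx, he.orth₁₂ t ht x hx]
  linear_combination -(omega0 ε e₁ e₂ t x * (covU γ e₁ e₂ t x).re) * hε

/-- Parallelism gives `η(e_{1x}, e₂) = 0`; its `t`-derivative supplies `η(e_{1tx}, e₂)`, and the
remaining term is `η(e_{1t}, e_{2x}) = u₂ ω₁`. -/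
theorem hasDerivAt_omega0 (hγ : IsInelasticFlow ε A K γ)
    (he : IsParallelFrame ε A K γ e₁ e₂) {t x : ℝ} (ht : t ∈ A) (hx : x ∈ K) :
    HasDerivAt (fun y => omega0 ε e₁ e₂ t y)
      (-ε * (covOmega γ e₁ e₂ t x * star (covU γ e₁ e₂ t x)).im) x := by
  have hA := hγ.openA
  have hK := hγ.openK
  have hs : SmoothOn A K e₁ := he.smooth₁
  have hs' : SmoothOn A K e₂ := he.smooth₂
  have h3 := eta_pt_of_const hA hK (hs.px hA hK) hs' (c := 0) (fun t ht x hx => by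
    rw [px_e₁_eq hγ he ht hx, eta_smul_left, he.orth₂ t ht x hx, mul_zero]) ht hx
  rw [px_e₁_eq hγ he ht hx, eta_smul_left, eta_comm (px γ t x)] at h3
  refine ((hasDerivAt_eta ((hs.pt hA hK).hasDerivAt_px hA hK ht hx)
    (hs'.hasDerivAt_px hA hK ht hx)).const_mul ε).congr_deriv ?_
  rw [← hs.pt_px hA hK ht hx, px_e₂_eq hγ he ht hx, eta_smul_right]
  simp only [QuadraticAlgebra.im_mul, QuadraticAlgebra.re_star, QuadraticAlgebra.im_star, covOmega]
  linear_combination ε * h3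

theorem hPerp_re (hε : ε * ε = 1) (t x : ℝ) :
    (hPerp ε γ e₁ e₂ t x).re = -eta (pt γ t x) (e₁ t x) := by
  simp only [hPerp, h1, QuadraticAlgebra.re_smul, smul_eq_mul]
  linear_combination -eta (pt γ t x) (e₁ t x) * hε

theorem hPerp_im (hε : ε * ε = 1) (t x : ℝ) :
    (hPerp ε γ e₁ e₂ t x).im = -eta (pt γ t x) (e₂ t x) := by
  simp only [hPerp, h2, QuadraticAlgebra.im_smul, smul_eq_mul]
  linear_combination -eta (pt γ t x) (e₂ t x) * hε

/-- Here `γ_{tx} = T_t`, and `η(T, e₁) = 0` differentiated in `t` identifies `η(T_t, e₁)` with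
`-ω₁`. -/
theorem hasDerivAt_hPerp_re (hε : ε * ε = 1) (hγ : IsInelasticFlow ε A K γ)
    (he : IsParallelFrame ε A K γ e₁ e₂) {t x : ℝ} (ht : t ∈ A) (hx : x ∈ K) :
    HasDerivAt (fun y => (hPerp ε γ e₁ e₂ t y).re)
      ((covOmega γ e₁ e₂ t x).re - hPar γ t x * (covU γ e₁ e₂ t x).re) x := by
  have hA := hγ.openA
  have hK := hγ.openK
  have hs0 : SmoothOn A K γ := hγ.smooth
  have hs : SmoothOn A K e₁ := he.smooth₁
  have h1 := eta_pt_of_const hA hK (hs0.px hA hK) hs he.orth₁ ht hx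
  rw [eta_comm (px γ t x)] at h1
  simp only [hPerp_re hε]
  refine (hasDerivAt_eta ((hs0.pt hA hK).hasDerivAt_px hA hK ht hx)
    (hs.hasDerivAt_px hA hK ht hx)).neg.congr_deriv ?_
  rw [← hs0.pt_px hA hK ht hx, px_e₁_eq hγ he ht hx, eta_smul_right]
  simp only [covOmega, hPar]
  linear_combination -h1

theorem hasDerivAt_hPerp_im (hε : ε * ε = 1) (hγ : IsInelasticFlow ε A K γ)
    (he : IsParallelFrame ε A K γ e₁ e₂) {t x : ℝ} (ht : t ∈ A) (hx : x ∈ K) :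
    HasDerivAt (fun y => (hPerp ε γ e₁ e₂ t y).im)
      ((covOmega γ e₁ e₂ t x).im - hPar γ t x * (covU γ e₁ e₂ t x).im) x := by
  have hA := hγ.openA
  have hK := hγ.openK
  have hs0 : SmoothOn A K γ := hγ.smooth
  have hs : SmoothOn A K e₂ := he.smooth₂
  have h1 := eta_pt_of_const hA hK (hs0.px hA hK) hs he.orth₂ ht hx
  rw [eta_comm (px γ t x)] at h1
  simp only [hPerp_im hε]
  refine (hasDerivAt_eta ((hs0.pt hA hK).hasDerivAt_px hA hK ht hx)
    (hs.hasDerivAt_px hA hK ht hx)).neg.congr_deriv ?_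
  rw [← hs0.pt_px hA hK ht hx, px_e₂_eq hγ he ht hx, eta_smul_right]
  simp only [covOmega, hPar]
  linear_combination -h1

/-- Inelasticity enters through `η(T_t, T) = 0`, which leaves only `η(γ_t, T_x)`. -/
theorem hasDerivAt_hPar (hε : ε * ε = 1) (hγ : IsInelasticFlow ε A K γ)
    (he : IsParallelFrame ε A K γ e₁ e₂) {t x : ℝ} (ht : t ∈ A) (hx : x ∈ K) :
    HasDerivAt (fun y => hPar γ t y)
      (-ε * (star (covU γ e₁ e₂ t x) * hPerp ε γ e₁ e₂ t x).re) x := by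
  have hA := hγ.openA
  have hK := hγ.openK
  have hs0 : SmoothOn A K γ := hγ.smooth
  have hT := hs0.px hA hK
  have h0 := eta_pt_of_const hA hK hT hT hγ.unit ht hx
  rw [eta_comm (px γ t x), ← two_mul] at h0
  refine (hasDerivAt_eta ((hs0.pt hA hK).hasDerivAt_px hA hK ht hx)
    (hT.hasDerivAt_px hA hK ht hx)).congr_deriv ?_
  rw [← hs0.pt_px hA hK ht hx, pxx_eq hε hγ he ht hx, eta_add_right, eta_smul_right,
    eta_smul_right, re_star_mul, ip, hPerp_re hε, hPerp_im hε]
  linear_combination h0 / 2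

/-! ### From the frame equations to the nonlocal operators. -/

theorem continuousOn_covU (hγ : IsInelasticFlow ε A K γ) (he : IsParallelFrame ε A K γ e₁ e₂)
    {t : ℝ} (ht : t ∈ A) : ContinuousOn (fun y => (covU γ e₁ e₂ t y).re) K ∧
      ContinuousOn (fun y => (covU γ e₁ e₂ t y).im) K := by
  have hA := hγ.openA
  have hK := hγ.openK
  have hT : SmoothOn A K (px γ) := SmoothOn.px hA hK hγ.smooth
  have hs : SmoothOn A K e₁ := he.smooth₁
  have hs' : SmoothOn A K e₂ := he.smooth₂
  exact ⟨fun y hy => (hasDerivAt_eta ((hs.px hA hK).hasDerivAt_px hA hK ht hy)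
      (hT.hasDerivAt_px hA hK ht hy)).continuousAt.continuousWithinAt,
    fun y hy => (hasDerivAt_eta ((hs'.px hA hK).hasDerivAt_px hA hK ht hy)
      (hT.hasDerivAt_px hA hK ht hy)).continuousAt.continuousWithinAt⟩

theorem antideriv_im_omega (hε : ε * ε = 1) (hγ : IsInelasticFlow ε A K γ)
    (he : IsParallelFrame ε A K γ e₁ e₂) {t x₀ x : ℝ} (ht : t ∈ A) (hx₀ : x₀ ∈ K) (hx : x ∈ K) :
    antideriv x₀ (-ε * omega0 ε e₁ e₂ t x₀)
      (fun y => (covOmega γ e₁ e₂ t y * star (covU γ e₁ e₂ t y)).im) x =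
      -ε * omega0 ε e₁ e₂ t x := by
  obtain ⟨c1, c2⟩ := continuousOn_covU hγ he ht
  have w1 : ContinuousOn (fun y => (covOmega γ e₁ e₂ t y).re) K := fun y hy =>
    (hasDerivAt_omega_re hε hγ he ht hy).continuousAt.continuousWithinAt
  have w2 : ContinuousOn (fun y => (covOmega γ e₁ e₂ t y).im) K := fun y hy =>
    (hasDerivAt_omega_im hε hγ he ht hy).continuousAt.continuousWithinAt
  refine antideriv_eq (G := fun y => -ε * omega0 ε e₁ e₂ t y) hγ.ordK hx₀ hx
    (fun y hy => ((hasDerivAt_omega0 hγ he ht hy).const_mul (-ε)).congr_deriv ?_) ?_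
  · linear_combination (covOmega γ e₁ e₂ t y * star (covU γ e₁ e₂ t y)).im * hε
  · refine ((w2.mul c1).sub (w1.mul c2)).congr fun y _ => ?_
    simp
    ring

theorem antideriv_re_hPerp (hε : ε * ε = 1) (hγ : IsInelasticFlow ε A K γ)
    (he : IsParallelFrame ε A K γ e₁ e₂) {t x₀ x : ℝ} (ht : t ∈ A) (hx₀ : x₀ ∈ K) (hx : x ∈ K) :
    antideriv x₀ (-ε * hPar γ t x₀)
      (fun y => (star (covU γ e₁ e₂ t y) * hPerp ε γ e₁ e₂ t y).re) x = -ε * hPar γ t x := by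
  obtain ⟨c1, c2⟩ := continuousOn_covU hγ he ht
  have w1 : ContinuousOn (fun y => (hPerp ε γ e₁ e₂ t y).re) K := fun y hy =>
    (hasDerivAt_hPerp_re hε hγ he ht hy).continuousAt.continuousWithinAt
  have w2 : ContinuousOn (fun y => (hPerp ε γ e₁ e₂ t y).im) K := fun y hy =>
    (hasDerivAt_hPerp_im hε hγ he ht hy).continuousAt.continuousWithinAt
  refine antideriv_eq (G := fun y => -ε * hPar γ t y) hγ.ordK hx₀ hx
    (fun y hy => ((hasDerivAt_hPar hε hγ he ht hy).const_mul (-ε)).congr_deriv ?_) ?_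
  · linear_combination (star (covU γ e₁ e₂ t y) * hPerp ε γ e₁ e₂ t y).re * hε
  · exact ((c1.mul w1).sub (c2.mul w2)).congr fun y _ => re_star_mul _ _

theorem covUt_eq (hε : ε * ε = 1) (hγ : IsInelasticFlow ε A K γ)
    (he : IsParallelFrame ε A K γ e₁ e₂) {t x : ℝ} (ht : t ∈ A) (hx : x ∈ K) :
    covUt γ e₁ e₂ t x = dx (covOmega γ e₁ e₂ t) x +
      omega0 ε e₁ e₂ t x • (jj * covU γ e₁ e₂ t x) := by
  have h1 := (hasDerivAt_omega_re hε hγ he ht hx).deriv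
  have h2 := (hasDerivAt_omega_im hε hγ he ht hx).deriv
  ext <;> simp [dx, h1, h2]

theorem covOmega_eq (hε : ε * ε = 1) (hγ : IsInelasticFlow ε A K γ)
    (he : IsParallelFrame ε A K γ e₁ e₂) {t x : ℝ} (ht : t ∈ A) (hx : x ∈ K) :
    covOmega γ e₁ e₂ t x = dx (hPerp ε γ e₁ e₂ t) x + hPar γ t x • covU γ e₁ e₂ t x := by
  have h1 := (hasDerivAt_hPerp_re hε hγ he ht hx).deriv
  have h2 := (hasDerivAt_hPerp_im hε hγ he ht hx).deriv
  ext <;> simp [dx, h1, h2]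

theorem covOmega_eq_opJ (hε : ε * ε = 1) (hγ : IsInelasticFlow ε A K γ)
    (he : IsParallelFrame ε A K γ e₁ e₂) {t x₀ x : ℝ} (ht : t ∈ A) (hx₀ : x₀ ∈ K) (hx : x ∈ K) :
    covOmega γ e₁ e₂ t x = opJ ε (antideriv x₀ (-ε * hPar γ t x₀)) (covU γ e₁ e₂ t)
      (hPerp ε γ e₁ e₂ t) x := by
  have h := antideriv_re_hPerp hε hγ he ht hx₀ hx
  simp only [re_star_mul] at h
  rw [covOmega_eq hε hγ he ht hx, opJ]
  simp only [re_mul_star]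
  rw [h, ← mul_assoc, mul_neg, hε, neg_one_mul, neg_smul, sub_neg_eq_add]

/-- The inner `R` gives `j ω`, and `R` applied to `j ω` is `H ω`. The first equality is known only
on `K`, so the derivative and the antiderivative must be replaced by congruence on the interval. -/
theorem covUt_eq_opR_opR (hε : ε * ε = 1) (hγ : IsInelasticFlow ε A K γ)
    (he : IsParallelFrame ε A K γ e₁ e₂) {t x₀ x : ℝ} (ht : t ∈ A) (hx₀ : x₀ ∈ K) (hx : x ∈ K) :
    covUt γ e₁ e₂ t x = opR ε (antideriv x₀ (-ε * omega0 ε e₁ e₂ t x₀)) (covU γ e₁ e₂ t)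
      (opR ε (antideriv x₀ (-ε * hPar γ t x₀)) (covU γ e₁ e₂ t) (hPerp ε γ e₁ e₂ t)) x := by
  have hR : ∀ y ∈ K, opR ε (antideriv x₀ (-ε * hPar γ t x₀)) (covU γ e₁ e₂ t)
      (hPerp ε γ e₁ e₂ t) y = jmul (covOmega γ e₁ e₂ t) y := fun y hy => by
    rw [opR_eq_jmul, jmul, jmul, covOmega_eq_opJ hε hγ he ht hx₀ hy]
  have h := antideriv_im_omega hε hγ he ht hx₀ hx
  rw [opR, dx_congr_of_eqOn hγ.openK hx hR, antideriv_congr hγ.ordK _ hx₀ hx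
    (g := fun y => (covOmega γ e₁ e₂ t y * star (covU γ e₁ e₂ t y)).im) fun y hy => ?_, h,
    covUt_eq hε hγ he ht hx, dx_jmul, ← mul_assoc, mul_neg, hε]
  · ext <;> simp [jmul]
  · rw [hR y hy, re_mul_star, im_mul_star]
    simp [ip, jmul]
    ring

end

end SpacelikeCurveFlow

end

/-! ### Assembly of the results. -/

theorem mainTheorem6 (ε : ℝ) (hε : ε = 1 ∨ ε = -1) :
    -- the evolution of the covariant `u` of an inelastic curve flow
    (∀ (A K : Set ℝ) (γ e₁ e₂ : ℝ → ℝ → Mink),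
      IsInelasticFlow ε A K γ → IsParallelFrame ε A K γ e₁ e₂ →
      ∀ t ∈ A, ∀ x₀ ∈ K, ∀ x ∈ K,
        let u := covU γ e₁ e₂ t
        let w := covOmega γ e₁ e₂ t
        let w₀ := omega0 ε e₁ e₂ t
        let hp := hPar γ t
        let h := hPerp ε γ e₁ e₂ t
        -- the components of the moving frame equations
        (pt γ t x = hp x • px γ t x + h1 ε γ e₁ t x • e₁ t x + h2 ε γ e₂ t x • e₂ t x ∧
          px e₁ t x = (u x).re • px γ t x ∧ px e₂ t x = (u x).im • px γ t x ∧
          pt e₁ t x = (w x).re • px γ t x + w₀ x • e₂ t x ∧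
          pt e₂ t x = (w x).im • px γ t x + w₀ x • e₁ t x) ∧
        -- `u_t = D_x ω ∓ j u D_x⁻¹ Im (ω ū) = H ω`
        covUt γ e₁ e₂ t x = dx w x -
          (ε * antideriv x₀ (-ε * w₀ x₀) (fun y => (w y * star (u y)).im) x) • (jj * u x) ∧
        covUt γ e₁ e₂ t x = opH ε (antideriv x₀ (ε * w₀ x₀)) u w x ∧
        -- `ω = D_x h ∓ u D_x⁻¹ Re (ū h) = J h`
        w x = dx h x -
          (ε * antideriv x₀ (-ε * hp x₀) (fun y => (star (u y) * h y).re) x) • u x ∧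
        w x = opJ ε (antideriv x₀ (-ε * hp x₀)) u h x ∧
        -- `u_t = R² h`
        covUt γ e₁ e₂ t x =
          opR ε (antideriv x₀ (-ε * w₀ x₀)) u (opR ε (antideriv x₀ (-ε * hp x₀)) u h) x) ∧
    -- invariance, Hamiltonian and symplectic properties, compatibility
    IsPhaseInvariant (opH ε skewInv) ∧ IsPhaseInvariant (opJ ε skewInv) ∧
    IsPhaseInvariant opI ∧ IsPhaseInvariant (opR ε skewInv) ∧
    IsHamiltonian (opH ε skewInv) ∧ IsSymplectic (opJ ε skewInv) ∧
    IsCompatibleSymplectic (opH ε skewInv) (opJ ε skewInv) ∧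
    IsHamiltonian opI ∧
    AreCompatible (opH ε skewInv) opI ∧
    IsCompatibleSymplectic opI (opJ ε skewInv) ∧
    -- the relations between the operators
    (∀ u X, IsTest u → IsTest X →
      opI u (opIinv u X) = X ∧ opIinv u (opI u X) = X ∧
      opH ε skewInv u (opIinv u X) = opI u (opJ ε skewInv u X) ∧
      opJ ε skewInv u (opI u X) = opIinv u (opH ε skewInv u X) ∧
      opR ε skewInv u X = opH ε skewInv u (opIinv u X) ∧
      opR ε skewInv u X = opI u (opJ ε skewInv u X) ∧
      opH ε skewInv u (opJ ε skewInv u X) = opR ε skewInv u (opR ε skewInv u X)) ∧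
    -- the hereditary recursion operator
    IsHereditary (opR ε skewInv) ∧
    (∀ n : ℕ, IsRecursion (opR ε skewInv)
      (fun u => (opR ε skewInv u)^[n] (fun x => jj * u x))) := by
  have hε2 : ε * ε = 1 := by rcases hε with rfl | rfl <;> norm_num
  have hH := isHamiltonian_pencil ε 1 0
  have hI := isHamiltonian_pencil ε 0 1
  have hHJ := isCompatibleSymplectic_pencil ε 1 0
  have hIJ := isCompatibleSymplectic_pencil ε 0 1
  rw [pencil_one_zero] at hH hHJ
  rw [pencil_zero_one] at hI hIJ
  refine ⟨?_, isPhaseInvariant_opH ε, isPhaseInvariant_opJ ε, isPhaseInvariant_opI,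
    isPhaseInvariant_opR ε, hH, isSymplectic_opJ ε, hHJ, hI, areCompatible_opH_opI ε, hIJ,
    fun u X _ _ => operator_relations ε u X, isHereditary_opR ε, isRecursion_hierarchy ε⟩
  intro A K γ e₁ e₂ hγ he t ht x₀ hx₀ x hx u w w₀ hp h
  have hu := covUt_eq hε2 hγ he ht hx
  have hw := covOmega_eq hε2 hγ he ht hx
  have hD := antideriv_im_omega hε2 hγ he ht hx₀ hx
  have hE := antideriv_re_hPerp hε2 hγ he ht hx₀ hx
  refine ⟨⟨curve_expand hε2 hγ he ht hx _, px_e₁_eq hγ he ht hx, px_e₂_eq hγ he ht hx,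
    pt_e₁_eq hε2 hγ he ht hx, pt_e₂_eq hε2 hγ he ht hx⟩, ?_, ?_, ?_,
    covOmega_eq_opJ hε2 hγ he ht hx₀ hx, covUt_eq_opR_opR hε2 hγ he ht hx₀ hx⟩
  · rw [hD, ← mul_assoc, mul_neg, hε2, neg_one_mul, neg_smul, sub_neg_eq_add]
    exact hu
  -- `H` is written with `Im (u ω̄) = -Im (ω ū)`, so both the integrand and the constant at `x₀`
  -- change sign.
  · have hn : antideriv x₀ (ε * w₀ x₀) (fun y => (u y * star (w y)).im) x = ε * w₀ x := by
      have h' : antideriv x₀ (ε * w₀ x₀) (fun y => (u y * star (w y)).im) x =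
          -antideriv x₀ (-ε * w₀ x₀) (fun y => (w y * star (u y)).im) x := by
        rw [antideriv, antideriv, neg_add, ← intervalIntegral.integral_neg]
        congr 1
        · ring
        · congr 1
          funext y
          simp only [QuadraticAlgebra.im_mul, QuadraticAlgebra.re_star, QuadraticAlgebra.im_star]
          ring
      rw [h', hD]
      ring
    rw [opH, hn, ← mul_assoc, hε2, one_mul]
    exact hu
  · rw [hE, ← mul_assoc, mul_neg, hε2, neg_one_mul, neg_smul, sub_neg_eq_add]
    exact hw
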